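/- Let $\mathbb D$ be the open unit disc, let $A$ be normalized area measure on $\mathbb D$, and let $\mathcal D$ be the Dirichlet space of analytic functions $f$ on $\mathbb D$ with $\|f\|_{\mathcal D}^2=|f(0)|^2+\int_{\mathbb D}|f'|^2\,dA<\infty$. Let $\mathcal M(\mathcal D)$ be the set of multipliers of $\mathcal D$, i.e. of the functions $u$ on $\mathbb D$ such that $uf\in\mathcal D$ for every $f\in\mathcal D$. For an analytic $\varphi:\mathbb D\to\mathbb D$ let $\mathcal M(\varphi)$ be the set of those $u\in\mathcal D$ for which $f\mapsto u\cdot(f\circ\varphi)$ is a bounded operator from $\mathcal D$ to $\mathcal D$. Let $\varphi$ be an inner function with $\varphi(\mathbb D)\subset\mathbb D$ (that is, an analytic self-map of $\mathbb D$ whose radial limits have modulus $1$ at almost every point of the unit circle). Then $\mathcal M(\varphi)=\mathcal M(\mathcal D)$ if and only if $\varphi$ is a finite Blaschke product, i.e. there are $n\ge 0$, a constant $c$ with $|c|=1$ and points $a_1,\dots,a_n\in\mathbb D$ such that $\varphi(z)=c\prod_{i=1}^n\frac{z-a_i}{1-\overline{a_i}\,z}$ for all $z\in\mathbb D$. -/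

import Mathlib

open scoped ENNReal NNReal Topology ComplexConjugate

noncomputable section

namespace DirichletSpace

/-! Analytic functions on the unit disc are represented by total functions `ℂ → ℂ`. Every notion
below depends only on the values taken on the open unit disc. -/

/-- The open unit disc of the complex plane. -/
def disc : Set ℂ := Metric.ball 0 1

/-- The normalized area measure of the unit disc (total mass one). -/
def area : MeasureTheory.Measure ℂ :=
  (ENNReal.ofReal Real.pi)⁻¹ • MeasureTheory.volume.restrict disc

/-- The square of the Dirichlet norm, `|f(0)|² + ∫_𝔻 |f'|² dA`, with values in `[0, ∞]`. -/
def normSq (f : ℂ → ℂ) : ℝ≥0∞ :=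
  ‖f 0‖ₑ ^ 2 + ∫⁻ z, ‖deriv f z‖ₑ ^ 2 ∂area

/-- The Dirichlet space: analytic functions on the disc with finite Dirichlet norm. -/
def dirichlet : Set (ℂ → ℂ) :=
  {f | DifferentiableOn ℂ f disc ∧ normSq f < ∞}

/-- The weighted composition operator `f ↦ u · (f ∘ φ)`. -/
def weightedComp (u φ f : ℂ → ℂ) : ℂ → ℂ := fun z => u z * f (φ z)

/-- An operator `T` on functions is bounded on the Dirichlet space: it maps the space into itself
and `‖T f‖ ≤ C ‖f‖` there, for some constant `C` (the inequality is written for squared norms). -/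
def BoundedOnDirichlet (T : (ℂ → ℂ) → (ℂ → ℂ)) : Prop :=
  ∃ C : ℝ≥0, ∀ f ∈ dirichlet, T f ∈ dirichlet ∧ normSq (T f) ≤ (C : ℝ≥0∞) ^ 2 * normSq f

/-- The multiplier space of a self-map `φ` of the disc. -/
def multiplierSpace (φ : ℂ → ℂ) : Set (ℂ → ℂ) :=
  {u | u ∈ dirichlet ∧ BoundedOnDirichlet (weightedComp u φ)}

/-- The multiplier algebra of the Dirichlet space: the `u` for which `f ↦ u f` maps the whole
Dirichlet space into itself. Such a `u` lies in the Dirichlet space (take `f = 1`). -/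
def multipliers : Set (ℂ → ℂ) :=
  {u | ∀ f ∈ dirichlet, (fun z => u z * f z) ∈ dirichlet}

/-- An inner function: analytic on the disc, bounded by one there, with radial limits of modulus
one at almost every point of the unit circle. -/
structure IsInner (φ : ℂ → ℂ) : Prop where
  differentiableOn : DifferentiableOn ℂ φ disc
  norm_le_one : ∀ z ∈ disc, ‖φ z‖ ≤ 1
  radial_limit : ∀ᵐ θ : ℝ, ∃ w : ℂ, ‖w‖ = 1 ∧
    Filter.Tendsto (fun r : ℝ => φ (r * Complex.exp (θ * Complex.I))) (𝓝[<] 1) (𝓝 w)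

/-- A finite Blaschke product: a unimodular constant times a finite product of Blaschke factors,
with zeros in the disc repeated according to multiplicity. -/
def IsFiniteBlaschkeProduct (φ : ℂ → ℂ) : Prop :=
  ∃ (n : ℕ) (c : ℂ) (a : Fin n → ℂ), ‖c‖ = 1 ∧ (∀ i, a i ∈ disc) ∧
    ∀ z ∈ disc, φ z = c * ∏ i, (z - a i) / (1 - conj (a i) * z)

end DirichletSpace

end

/-!
For a finite Blaschke product `φ`, membership in `𝓜(φ)` amounts to being a multiplier of the
Dirichlet space `𝓓`, because `𝓓` is, up to finitely many smooth factors, generated by the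
compositions with `φ`. Everything is done with Taylor coefficients: Parseval's formula turns
`∫ |f'|² dA` into `∑ n |aₙ|²`, which equals `∑ ‖Bᵐ x‖²` over `m ≥ 1`, where `x` is the coefficient
sequence in the Hardy space `H²` and `B` is the backward shift.

*Finite Blaschke products.* Following `φ` by a disc automorphism, one may assume `φ(0) = 0`. Let `V`
be multiplication by `φ` on `H²`. Three facts, proved for a single Blaschke factor and then for
products, suffice (`IsModelOperator`): `V` is an isometry commuting with the shift, it increases the
Dirichlet integral by at most `K ‖x‖²`, and `1 - V V†` has finite rank with range spanned by
functions analytic across the circle. For one factor, the isometry and the bound on the Dirichlet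
integral both come from `‖u - a v‖² - ‖v - ā u‖² = (1 - |a|²) (‖u‖² - ‖v‖²)`.
* The composition operator `C` with `φ` satisfies `C x = x₀ + V (C (B x))`, hence the Dirichlet
  integral of `C x` is at most `K ∑ ‖Bᵐ x‖²`, so that `f ∘ φ ∈ 𝓓` for `f ∈ 𝓓`
  (`IsModelOperator.comp_mem_dirichlet`). A multiplier `u` therefore maps `f ∘ φ` into `𝓓`, and the
  closed graph theorem gives boundedness (`boundedOnDirichlet_of_mapsTo`).
* Iterating `x = (1 - V V†) x + V (V† x)` writes `f ∈ 𝓓` as a finite sum `∑ hᵢ · (Gᵢ ∘ φ)`.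
  As `V` factors through the shift, `‖V†ᵐ x‖ ≤ ‖Bᵐ x‖`, and this puts the `Gᵢ` into `𝓓`
  (`IsModelOperator.exists_decomposition`). If `u · (G ∘ φ) ∈ 𝓓` for every `G ∈ 𝓓`, then
  `u f = ∑ hᵢ · u · (Gᵢ ∘ φ)` lies in `𝓓`.

*The converse.* If the two spaces agree, then `1 ∈ 𝓜(φ)` and so `φ ∈ 𝓓`. For an inner `φ`,
multiplication by `φ` is again an isometry `V` of `H²`. The projection `Q = 1 - V V†` is then
Hilbert–Schmidt, with squared norm `∑ n |aₙ|²`, while `‖Q k‖² = (1 - |φ(z)|²) ‖k‖²` for the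
reproducing kernel `k` at `z`. The normalized kernels tend weakly to zero at the circle, so
`|φ| → 1` there (`IsInner.unimodularAtBoundary`). Dividing out the zeros, finitely many, leaves a
unimodular constant (`UnimodularAtBoundary.isFiniteBlaschkeProduct`).
-/

namespace DirichletSpace

open MeasureTheory Filter Complex
open ContinuousLinearMap (adjoint)

/-! ### Taylor series on the disc and Parseval's formula on circles -/

/-- `f` is represented on the unit disc by the power series with coefficients `a`. -/
def IsTaylor (a : ℕ → ℂ) (f : ℂ → ℂ) : Prop :=
  ∀ z ∈ disc, HasSum (fun n => a n * z ^ n) (f z)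

lemma mem_disc {z : ℂ} : z ∈ disc ↔ ‖z‖ < 1 := by simp [disc]

lemma isOpen_disc : IsOpen disc := Metric.isOpen_ball

lemma zero_mem_disc : (0 : ℂ) ∈ disc := by simp [mem_disc]

lemma isTaylor_of_differentiableOn {f : ℂ → ℂ} (hf : DifferentiableOn ℂ f disc) :
    IsTaylor (fun n => (n.factorial : ℂ)⁻¹ * iteratedDeriv n f 0) f := by
  intro z hz
  have := Complex.hasSum_taylorSeries_on_ball (c := 0) (r := 1) hf hz
  convert! this using 2 with n
  simp only [smul_eq_mul, sub_zero]
  ring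

lemma IsTaylor.summable_norm {a : ℕ → ℂ} {f : ℂ → ℂ} (h : IsTaylor a f) {r : ℝ} (h0 : 0 ≤ r)
    (h1 : r < 1) : Summable fun n => ‖a n‖ * r ^ n := by
  have := (h (r : ℂ) (by simpa [mem_disc, abs_of_nonneg h0] using h1)).summable.norm
  simpa [abs_of_nonneg h0] using this

lemma IsTaylor.hasFPowerSeriesOnBall {a : ℕ → ℂ} {f : ℂ → ℂ} (h : IsTaylor a f) :
    HasFPowerSeriesOnBall f (FormalMultilinearSeries.ofScalars ℂ a) 0 1 where
  r_le := by
    refine ENNReal.le_of_forall_nnreal_lt fun r hr => ?_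
    refine FormalMultilinearSeries.le_radius_of_summable _ ?_
    simpa using h.summable_norm r.2 (by exact_mod_cast hr)
  r_pos := one_pos
  hasSum := by
    intro y hy
    have hy' : y ∈ disc := by
      rw [mem_disc]
      simpa [Metric.mem_eball, edist_zero_right, ← ofReal_norm, ENNReal.ofReal_lt_one] using hy
    simpa [FormalMultilinearSeries.ofScalars_apply_eq, mul_comm] using h y hy'

lemma IsTaylor.differentiableOn {a : ℕ → ℂ} {f : ℂ → ℂ} (h : IsTaylor a f) :
    DifferentiableOn ℂ f disc := by
  have := h.hasFPowerSeriesOnBall.differentiableOn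
  convert! this using 1
  simp [disc, ← Metric.eball_ofReal]

lemma IsTaylor.unique {a b : ℕ → ℂ} {f : ℂ → ℂ} (ha : IsTaylor a f) (hb : IsTaylor b f) :
    a = b :=
  FormalMultilinearSeries.ofScalars_series_injective ℂ ℂ
    (ha.hasFPowerSeriesOnBall.hasFPowerSeriesAt.eq_formalMultilinearSeries
      hb.hasFPowerSeriesOnBall.hasFPowerSeriesAt)

lemma IsTaylor.congr {a : ℕ → ℂ} {f g : ℂ → ℂ} (h : IsTaylor a f) (hfg : Set.EqOn f g disc) :
    IsTaylor a g := fun z hz => hfg hz ▸ h z hz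

lemma IsTaylor.deriv {a : ℕ → ℂ} {f : ℂ → ℂ} (h : IsTaylor a f) :
    IsTaylor (fun n => (n + 1) * a (n + 1)) (deriv f) := by
  have hd := h.differentiableOn
  have h1 := h.unique (isTaylor_of_differentiableOn hd)
  convert! isTaylor_of_differentiableOn (hd.deriv isOpen_disc) using 2 with n
  rw [h1, ← iteratedDeriv_succ']
  have : (n.factorial : ℂ) ≠ 0 := by exact_mod_cast n.factorial_ne_zero
  have : (n : ℂ) + 1 ≠ 0 := by exact_mod_cast n.succ_ne_zero
  simp only [Nat.factorial_succ]
  push_cast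
  field_simp

lemma IsTaylor.apply_zero {a : ℕ → ℂ} {f : ℂ → ℂ} (h : IsTaylor a f) : f 0 = a 0 := by
  refine (h 0 zero_mem_disc).unique ?_
  convert hasSum_ite_eq 0 (a 0) using 2 with n
  rcases n with _ | n <;> simp

/-- The integral of `e^{inθ}` over a period. -/
lemma integral_exp_int (n : ℤ) :
    ∫ θ in (-Real.pi)..Real.pi, exp (n * (θ * I)) = if n = 0 then 2 * Real.pi else 0 := by
  split_ifs with hn
  · subst hn; simp; ring
  · have : ∀ θ : ℝ, exp (n * (θ * I)) = exp ((n * I) * θ) := fun θ => by ring_nf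
    simp_rw [this]
    have hne : (n : ℂ) * I ≠ 0 := by simp [hn]
    rw [integral_exp_mul_complex hne]
    have : exp (n * I * (Real.pi : ℝ)) = exp (n * I * ((-Real.pi : ℝ) : ℂ)) := by
      rw [Complex.exp_eq_exp_iff_exists_int]
      exact ⟨n, by push_cast; ring⟩
    rw [this]; simp

/-- A factor given by an absolutely convergent Fourier series may be integrated term by term. -/
lemma hasSum_integral_fourier_mul {c : ℕ → ℂ} (hc : Summable fun n => ‖c n‖) {F G : ℝ → ℂ}
    (hF : ∀ θ : ℝ, HasSum (fun n => c n * exp (n * (θ * I))) (F θ)) (hG : Continuous G) :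
    HasSum (fun n => c n * ∫ θ in (-Real.pi)..Real.pi, exp (n * (θ * I)) * G θ)
      (∫ θ in (-Real.pi)..Real.pi, F θ * G θ) := by
  have := intervalIntegral.hasSum_integral_of_dominated_convergence (μ := volume)
    (a := -Real.pi) (b := Real.pi) (F := fun n θ => c n * (exp (n * (θ * I)) * G θ))
    (f := fun θ => F θ * G θ) (fun n θ => ‖c n‖ * ‖G θ‖) ?_ ?_ ?_ ?_ ?_
  · simpa only [intervalIntegral.integral_const_mul] using this
  · intro n
    exact (by fun_prop :
      Continuous fun θ : ℝ => c n * (exp (n * (θ * I)) * G θ)).aestronglyMeasurable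
  · intro n
    refine ae_of_all _ fun θ _ => ?_
    have : ‖exp (n * (θ * I))‖ = 1 := by
      rw [← Complex.norm_exp_ofReal_mul_I (n * θ)]; push_cast; ring_nf
    simp [this]
  · exact ae_of_all _ fun θ _ => hc.mul_right _
  · simp_rw [tsum_mul_right]
    exact (by fun_prop : Continuous fun θ : ℝ => (∑' n, ‖c n‖) * ‖G θ‖).intervalIntegrable _ _
  · refine ae_of_all _ fun θ _ => ?_
    simpa [mul_assoc] using (hF θ).mul_right (G θ)

lemma circle_mem_disc {r : ℝ} (h0 : 0 ≤ r) (h1 : r < 1) (θ : ℝ) :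
    (r : ℂ) * exp (θ * I) ∈ disc := by
  simpa [mem_disc, Complex.norm_exp_ofReal_mul_I, abs_of_nonneg h0] using h1

lemma IsTaylor.continuous_circle {a : ℕ → ℂ} {f : ℂ → ℂ} (h : IsTaylor a f) {r : ℝ} (h0 : 0 ≤ r)
    (h1 : r < 1) : Continuous fun θ : ℝ => f (r * exp (θ * I)) :=
  h.differentiableOn.continuousOn.comp_continuous (by fun_prop)
    fun θ => circle_mem_disc h0 h1 θ

lemma IsTaylor.hasSum_circle {a : ℕ → ℂ} {f : ℂ → ℂ} (h : IsTaylor a f) {r : ℝ} (h0 : 0 ≤ r)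
    (h1 : r < 1) (θ : ℝ) :
    HasSum (fun n : ℕ => a n * (r : ℂ) ^ n * exp (n * (θ * I))) (f (r * exp (θ * I))) := by
  convert! h _ (circle_mem_disc h0 h1 θ) using 2 with n
  rw [mul_pow, ← Complex.exp_nat_mul, mul_assoc]

lemma IsTaylor.summable_circle {a : ℕ → ℂ} {f : ℂ → ℂ} (h : IsTaylor a f) {r : ℝ} (h0 : 0 ≤ r)
    (h1 : r < 1) : Summable fun n : ℕ => ‖a n * (r : ℂ) ^ n‖ := by
  simpa [abs_of_nonneg h0] using h.summable_norm h0 h1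

/-- Cauchy's formula for the Taylor coefficients, on the circle of radius `r`. -/
lemma IsTaylor.circle_coeff {a : ℕ → ℂ} {f : ℂ → ℂ} (h : IsTaylor a f) {r : ℝ} (h0 : 0 ≤ r)
    (h1 : r < 1) (k : ℕ) :
    ∫ θ in (-Real.pi)..Real.pi, f (r * exp (θ * I)) * exp (-(k * (θ * I))) =
      2 * Real.pi * (a k * r ^ k) := by
  have hs := hasSum_integral_fourier_mul (h.summable_circle h0 h1) (h.hasSum_circle h0 h1)
    (G := fun θ => exp (-(k * (θ * I)))) (by fun_prop)
  refine hs.unique ?_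
  convert hasSum_ite_eq k (2 * Real.pi * (a k * r ^ k) : ℂ) using 2 with n
  have : ∀ θ : ℝ, exp (n * (θ * I)) * exp (-(k * (θ * I))) = exp (((n - k : ℤ) : ℂ) * (θ * I)) := by
    intro θ; rw [← Complex.exp_add]; push_cast; ring_nf
  simp_rw [this, integral_exp_int, sub_eq_zero, Nat.cast_inj]
  split_ifs with hnk
  · subst hnk; push_cast; ring
  · simp

/-- Parseval's formula for `|f|²` against `e^{imθ}` on the circle of radius `r`. -/
lemma IsTaylor.circle_correlation {a : ℕ → ℂ} {f : ℂ → ℂ} (h : IsTaylor a f) {r : ℝ} (h0 : 0 ≤ r)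
    (h1 : r < 1) (m : ℕ) :
    HasSum (fun n => 2 * Real.pi * (a n * conj (a (n + m)) * r ^ (2 * n + m)))
      (∫ θ in (-Real.pi)..Real.pi,
        f (r * exp (θ * I)) * (exp (m * (θ * I)) * conj (f (r * exp (θ * I))))) := by
  have hcont := h.continuous_circle h0 h1
  have hs := hasSum_integral_fourier_mul (h.summable_circle h0 h1) (h.hasSum_circle h0 h1)
    (G := fun θ => exp (m * (θ * I)) * conj (f (r * exp (θ * I))))
    ((by fun_prop : Continuous fun θ : ℝ => exp (m * (θ * I))).mul
      (Complex.continuous_conj.comp hcont))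
  convert! hs using 2 with n
  have h2 := congrArg conj (h.circle_coeff h0 h1 (n + m))
  rw [intervalIntegral.integral_of_le (by linarith [Real.pi_pos]), ← integral_conj,
    ← intervalIntegral.integral_of_le (by linarith [Real.pi_pos])] at h2
  have : ∀ θ : ℝ, exp (n * (θ * I)) * (exp (m * (θ * I)) * conj (f (r * exp (θ * I)))) =
      conj (f (r * exp (θ * I)) * exp (-(((n + m : ℕ) : ℂ) * (θ * I)))) := by
    intro θ
    rw [map_mul, ← Complex.exp_conj, ← mul_assoc, ← Complex.exp_add, mul_comm]
    congr 2
    simp only [map_neg, map_mul, conj_I, conj_ofReal, map_natCast]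
    push_cast; ring
  simp_rw [this, h2]
  simp only [map_mul, conj_ofReal, map_pow, map_ofNat]
  ring

lemma IsTaylor.circle_parseval {a : ℕ → ℂ} {f : ℂ → ℂ} (h : IsTaylor a f) {r : ℝ} (h0 : 0 ≤ r)
    (h1 : r < 1) :
    HasSum (fun n => 2 * Real.pi * (‖a n‖ ^ 2 * r ^ (2 * n)))
      (∫ θ in (-Real.pi)..Real.pi, ‖f (r * exp (θ * I))‖ ^ 2) := by
  have := h.circle_correlation h0 h1 0
  simp only [Nat.cast_zero, zero_mul, Complex.exp_zero, one_mul, add_zero, Complex.mul_conj,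
    Complex.normSq_eq_norm_sq] at this
  rw [intervalIntegral.integral_ofReal] at this
  exact_mod_cast this

/-! ### The Dirichlet space in terms of Taylor coefficients -/

lemma lintegral_area (h : ℂ → ℝ≥0∞) :
    ∫⁻ z, h z ∂area = (ENNReal.ofReal Real.pi)⁻¹ * ∫⁻ z in disc, h z := by
  rw [area, lintegral_smul_measure, smul_eq_mul]

lemma IsTaylor.lintegral_circle {a : ℕ → ℂ} {f : ℂ → ℂ} (h : IsTaylor a f) {r : ℝ} (h0 : 0 ≤ r)
    (h1 : r < 1) :
    ∫⁻ θ in Set.Ioo (-Real.pi) Real.pi, ‖f (r * exp (θ * I))‖ₑ ^ 2 =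
      ∑' n, ENNReal.ofReal (2 * Real.pi * (‖a n‖ ^ 2 * r ^ (2 * n))) := by
  have hs := h.circle_parseval h0 h1
  rw [← ENNReal.ofReal_tsum_of_nonneg (fun n => by positivity) hs.summable, hs.tsum_eq,
    intervalIntegral.integral_of_le (by linarith [Real.pi_pos]), integral_Ioc_eq_integral_Ioo,
    ofReal_integral_eq_lintegral_ofReal]
  · simp [ENNReal.ofReal_pow, ofReal_norm]
  · exact (((h.continuous_circle h0 h1).norm.pow 2).integrableOn_Icc (a := -Real.pi)
      (b := Real.pi)).mono_set Set.Ioo_subset_Icc_self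
  · exact ae_of_all _ fun θ => by positivity

lemma lintegral_Ioo_pow (n : ℕ) (c : ℝ) (hc : 0 ≤ c) :
    ∫⁻ r in Set.Ioo (0 : ℝ) 1, ENNReal.ofReal (c * r ^ n) = ENNReal.ofReal (c / (n + 1)) := by
  rw [← ofReal_integral_eq_lintegral_ofReal, ← integral_Ioc_eq_integral_Ioo,
    ← intervalIntegral.integral_of_le zero_le_one]
  · simp [integral_pow, div_eq_mul_inv]
  · exact ((by fun_prop : Continuous fun r : ℝ => c * r ^ n).integrableOn_Icc (a := 0)
      (b := 1)).mono_set Set.Ioo_subset_Icc_self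
  · refine (ae_restrict_iff' measurableSet_Ioo).2 (ae_of_all _ fun r hr => ?_)
    have := hr.1.le
    simp only [Pi.zero_apply]; positivity

/-- Parseval's formula for the area integral over the disc. -/
lemma IsTaylor.lintegral_area {a : ℕ → ℂ} {f : ℂ → ℂ} (h : IsTaylor a f) :
    ∫⁻ z, ‖f z‖ₑ ^ 2 ∂area = ∑' n, ENNReal.ofReal (‖a n‖ ^ 2 / (n + 1)) := by
  classical
  set F : ℂ → ℝ≥0∞ := disc.indicator fun z => ‖f z‖ₑ ^ 2 with hF
  have hmeas : Measurable F := by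
    have h1 : Measurable (disc.indicator f) := by
      rw [← Set.piecewise_eq_indicator]
      exact h.differentiableOn.continuousOn.measurable_piecewise continuousOn_const
        isOpen_disc.measurableSet
    have h2 : F = fun z => ‖disc.indicator f z‖ₑ ^ 2 := by
      ext z; by_cases hz : z ∈ disc <;> simp [hF, hz]
    rw [h2]; fun_prop
  have hin : ∀ r : ℝ, 0 < r → ∫⁻ θ in Set.Ioo (-Real.pi) Real.pi,
      ENNReal.ofReal r * F (Complex.polarCoord.symm (r, θ)) =
      (Set.Ioo (0 : ℝ) 1).indicator (fun r => ∑' n, ENNReal.ofReal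
        (2 * Real.pi * ‖a n‖ ^ 2 * r ^ (2 * n + 1))) r := by
    intro r hr
    have hp : ∀ θ : ℝ, Complex.polarCoord.symm (r, θ) = r * exp (θ * I) := by
      intro θ; rw [Complex.polarCoord_symm_apply, Complex.exp_mul_I]; simp
    simp_rw [hp]
    by_cases h1 : r < 1
    · rw [Set.indicator_of_mem (show r ∈ Set.Ioo (0 : ℝ) 1 from ⟨hr, h1⟩),
        lintegral_const_mul' _ _ ENNReal.ofReal_ne_top]
      have : ∀ θ : ℝ, F (r * exp (θ * I)) = ‖f (r * exp (θ * I))‖ₑ ^ 2 := fun θ =>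
        Set.indicator_of_mem (circle_mem_disc hr.le h1 θ) _
      simp_rw [this]
      rw [h.lintegral_circle hr.le h1, ← ENNReal.tsum_mul_left]
      congr 1; ext n
      rw [← ENNReal.ofReal_mul hr.le]
      congr 1; ring
    · rw [Set.indicator_of_notMem (fun h => h1 h.2)]
      have : ∀ θ : ℝ, F (r * exp (θ * I)) = 0 := fun θ => by
        refine Set.indicator_of_notMem ?_ _
        simpa [mem_disc, Complex.norm_exp_ofReal_mul_I, abs_of_pos hr] using h1
      simp [this]
  rw [DirichletSpace.lintegral_area, ← lintegral_indicator isOpen_disc.measurableSet,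
    ← Complex.lintegral_comp_polarCoord_symm]
  have ht : polarCoord.target = Set.Ioi (0 : ℝ) ×ˢ Set.Ioo (-Real.pi) Real.pi := rfl
  simp only [smul_eq_mul]
  rw [ht, Measure.volume_eq_prod, ← Measure.prod_restrict, lintegral_prod]
  · rw [setLIntegral_congr_fun measurableSet_Ioi (fun r hr => hin r hr),
      lintegral_indicator measurableSet_Ioo, Measure.restrict_restrict measurableSet_Ioo,
      Set.inter_eq_left.2 Set.Ioo_subset_Ioi_self, lintegral_tsum]
    · rw [← ENNReal.tsum_mul_left]
      congr 1; ext n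
      rw [lintegral_Ioo_pow _ _ (by positivity), ← ENNReal.ofReal_inv_of_pos Real.pi_pos,
        ← ENNReal.ofReal_mul (by positivity)]
      congr 1
      push_cast
      field_simp
      ring
    · intro n; fun_prop
  · refine Measurable.aemeasurable ?_
    have : Measurable fun p : ℝ × ℝ => Complex.polarCoord.symm p := by
      simp_rw [Complex.polarCoord_symm_apply]
      fun_prop
    exact (ENNReal.measurable_ofReal.comp measurable_fst).mul (hmeas.comp this)

/-- The Dirichlet norm in terms of Taylor coefficients. -/
lemma IsTaylor.normSq_eq {a : ℕ → ℂ} {f : ℂ → ℂ} (h : IsTaylor a f) :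
    normSq f = ∑' n : ℕ, ENNReal.ofReal (max (n : ℝ) 1 * ‖a n‖ ^ 2) := by
  rw [normSq, h.deriv.lintegral_area, h.apply_zero, ← ofReal_norm,
    ← ENNReal.ofReal_pow (norm_nonneg _),
    tsum_eq_zero_add' (f := fun n : ℕ => ENNReal.ofReal (max (n : ℝ) 1 * ‖a n‖ ^ 2))
      ENNReal.summable]
  congr 1
  · simp
  · congr 1; ext n
    congr 1
    have h1 : ‖((n : ℂ) + 1)‖ = n + 1 := by
      rw [← Nat.cast_succ, Complex.norm_natCast, Nat.cast_succ]
    have : (0 : ℝ) < n + 1 := by positivity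
    rw [max_eq_left (by push_cast; linarith [(Nat.cast_nonneg n : (0 : ℝ) ≤ n)]), norm_mul, h1]
    push_cast
    field_simp

lemma IsTaylor.mem_dirichlet_iff' {a : ℕ → ℂ} {f : ℂ → ℂ} (h : IsTaylor a f) :
    f ∈ dirichlet ↔ Summable fun n : ℕ => max (n : ℝ) 1 * ‖a n‖ ^ 2 := by
  have h0 : ∀ n : ℕ, 0 ≤ max (n : ℝ) 1 * ‖a n‖ ^ 2 := fun n => by positivity
  constructor
  · intro hf
    have := hf.2
    rw [h.normSq_eq] at this
    have := ENNReal.summable_toReal this.ne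
    exact this.congr fun n => ENNReal.toReal_ofReal (h0 n)
  · intro hs
    exact ⟨h.differentiableOn, by rw [h.normSq_eq]; exact hs.tsum_ofReal_lt_top⟩

lemma summable_max_iff {a : ℕ → ℂ} : (Summable fun n : ℕ => max (n : ℝ) 1 * ‖a n‖ ^ 2) ↔
    Summable fun n : ℕ => (n : ℝ) * ‖a n‖ ^ 2 := by
  rw [← summable_nat_add_iff 1, ← summable_nat_add_iff (f := fun n : ℕ => (n : ℝ) * ‖a n‖ ^ 2) 1]
  refine summable_congr fun n => ?_
  rw [max_eq_left]
  push_cast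
  linarith [(Nat.cast_nonneg n : (0 : ℝ) ≤ n)]

lemma IsTaylor.mem_dirichlet_iff {a : ℕ → ℂ} {f : ℂ → ℂ} (h : IsTaylor a f) :
    f ∈ dirichlet ↔ Summable fun n : ℕ => (n : ℝ) * ‖a n‖ ^ 2 :=
  h.mem_dirichlet_iff'.trans summable_max_iff

lemma dirichlet_exists_isTaylor {f : ℂ → ℂ} (hf : f ∈ dirichlet) :
    ∃ a, IsTaylor a f ∧ Summable fun n : ℕ => (n : ℝ) * ‖a n‖ ^ 2 :=
  ⟨_, isTaylor_of_differentiableOn hf.1,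
    (isTaylor_of_differentiableOn hf.1).mem_dirichlet_iff.1 hf⟩

lemma summable_sq_of_summable_mul_sq {a : ℕ → ℂ}
    (h : Summable fun n : ℕ => (n : ℝ) * ‖a n‖ ^ 2) : Summable fun n : ℕ => ‖a n‖ ^ 2 :=
  (summable_max_iff.2 h).of_nonneg_of_le (fun n => by positivity) fun n =>
    le_mul_of_one_le_left (by positivity) (le_max_right _ _)

lemma lintegral_sq_lt_top {f : ℂ → ℂ} (hf : f ∈ dirichlet) : ∫⁻ z, ‖f z‖ₑ ^ 2 ∂area < ∞ := by
  obtain ⟨a, ha, hs⟩ := dirichlet_exists_isTaylor hf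
  rw [ha.lintegral_area]
  refine Summable.tsum_ofReal_lt_top ?_
  refine (summable_sq_of_summable_mul_sq hs).of_nonneg_of_le (fun n => by positivity) fun n => ?_
  exact div_le_self (by positivity) (by linarith [(Nat.cast_nonneg n : (0 : ℝ) ≤ n)])

lemma normSq_congr {f g : ℂ → ℂ} (h : Set.EqOn f g disc) : normSq f = normSq g := by
  rw [normSq, normSq, h zero_mem_disc, lintegral_area, lintegral_area]
  congr 2
  refine setLIntegral_congr_fun isOpen_disc.measurableSet fun z hz => ?_
  rw [(h.eventuallyEq_of_mem (isOpen_disc.mem_nhds hz)).deriv_eq]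

lemma dirichlet_congr {f g : ℂ → ℂ} (h : Set.EqOn f g disc) (hf : f ∈ dirichlet) :
    g ∈ dirichlet :=
  ⟨hf.1.congr fun z hz => (h hz).symm, by rw [← normSq_congr h]; exact hf.2⟩

lemma mem_dirichlet_iff_lintegral {f : ℂ → ℂ} (hf : DifferentiableOn ℂ f disc) :
    f ∈ dirichlet ↔ ∫⁻ z, ‖deriv f z‖ₑ ^ 2 ∂area < ∞ := by
  simp only [dirichlet, Set.mem_ofPred_eq, hf, true_and, normSq, ENNReal.add_lt_top,
    and_iff_right_iff_imp]
  exact fun _ => ENNReal.pow_lt_top enorm_lt_top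

lemma enorm_add_sq_le (x y : ℂ) : ‖x + y‖ₑ ^ 2 ≤ 2 * (‖x‖ₑ ^ 2 + ‖y‖ₑ ^ 2) := by
  calc ‖x + y‖ₑ ^ 2 ≤ (‖x‖ₑ + ‖y‖ₑ) ^ 2 := by gcongr; exact enorm_add_le x y
    _ ≤ 2 * (‖x‖ₑ ^ 2 + ‖y‖ₑ ^ 2) := by
      have := ENNReal.rpow_add_le_mul_rpow_add_rpow ‖x‖ₑ ‖y‖ₑ (p := 2) (by norm_num)
      norm_num at this
      exact_mod_cast this

lemma lintegral_enorm_add_sq_lt_top {f g : ℂ → ℂ} (hfm : AEMeasurable f area)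
    (hf : ∫⁻ z, ‖f z‖ₑ ^ 2 ∂area < ∞) (hg : ∫⁻ z, ‖g z‖ₑ ^ 2 ∂area < ∞) :
    ∫⁻ z, ‖f z + g z‖ₑ ^ 2 ∂area < ∞ := by
  refine (lintegral_mono fun z => enorm_add_sq_le (f z) (g z)).trans_lt ?_
  rw [lintegral_const_mul' _ _ (by norm_num), lintegral_add_left' (by fun_prop)]
  exact ENNReal.mul_lt_top (by norm_num) (ENNReal.add_lt_top.2 ⟨hf, hg⟩)

lemma lintegral_congr_disc {f g : ℂ → ℝ≥0∞} (h : Set.EqOn f g disc) :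
    ∫⁻ z, f z ∂area = ∫⁻ z, g z ∂area := by
  rw [lintegral_area, lintegral_area, setLIntegral_congr_fun isOpen_disc.measurableSet h]

lemma lintegral_mono_disc {f g : ℂ → ℝ≥0∞} (h : ∀ z ∈ disc, f z ≤ g z) :
    ∫⁻ z, f z ∂area ≤ ∫⁻ z, g z ∂area := by
  rw [lintegral_area, lintegral_area]
  gcongr 1
  exact setLIntegral_mono' isOpen_disc.measurableSet h

lemma aemeasurable_area {f : ℂ → ℂ} (hf : ContinuousOn f disc) : AEMeasurable f area :=
  (hf.aemeasurable isOpen_disc.measurableSet).smul_measure _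

lemma dirichlet_add {f g : ℂ → ℂ} (hf : f ∈ dirichlet) (hg : g ∈ dirichlet) :
    (fun z => f z + g z) ∈ dirichlet := by
  rw [mem_dirichlet_iff_lintegral (hf.1.fun_add hg.1), lintegral_congr_disc
    (g := fun z => ‖deriv f z + deriv g z‖ₑ ^ 2)]
  · exact lintegral_enorm_add_sq_lt_top (aemeasurable_area (hf.1.deriv isOpen_disc).continuousOn)
      ((mem_dirichlet_iff_lintegral hf.1).1 hf) ((mem_dirichlet_iff_lintegral hg.1).1 hg)
  · intro z hz
    simp only
    rw [deriv_fun_add (hf.1.differentiableAt (isOpen_disc.mem_nhds hz))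
      (hg.1.differentiableAt (isOpen_disc.mem_nhds hz))]

lemma lintegral_enorm_mul_sq_lt_top {f h : ℂ → ℂ} {C : ℝ≥0} (hC : ∀ z ∈ disc, ‖h z‖ₑ ≤ C)
    (hf : ∫⁻ z, ‖f z‖ₑ ^ 2 ∂area < ∞) : ∫⁻ z, ‖h z * f z‖ₑ ^ 2 ∂area < ∞ := by
  refine (lintegral_mono_disc (g := fun z => (C : ℝ≥0∞) ^ 2 * ‖f z‖ₑ ^ 2)
    fun z hz => ?_).trans_lt ?_
  · rw [enorm_mul, mul_pow]
    gcongr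
    exact hC z hz
  · rw [lintegral_const_mul' _ _ (by simp)]
    exact ENNReal.mul_lt_top (by simp) hf

lemma exists_bound_of_continuousOn {h : ℂ → ℂ} (hh : ContinuousOn h (Metric.closedBall 0 1)) :
    ∃ C : ℝ≥0, ∀ z ∈ disc, ‖h z‖ₑ ≤ C := by
  obtain ⟨C, hC⟩ := (isCompact_closedBall (0 : ℂ) 1).exists_bound_of_continuousOn hh
  refine ⟨C.toNNReal, fun z hz => ?_⟩
  rw [← ofReal_norm]
  exact ENNReal.ofReal_le_ofReal (hC z (Metric.ball_subset_closedBall hz))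

/-- A function analytic across the unit circle is a multiplier of the Dirichlet space. -/
lemma analytic_mem_multipliers {h : ℂ → ℂ} (hh : AnalyticOnNhd ℂ h (Metric.closedBall 0 1)) :
    h ∈ multipliers := by
  intro f hf
  have hd : DifferentiableOn ℂ h disc := hh.differentiableOn.mono Metric.ball_subset_closedBall
  obtain ⟨C, hC⟩ := exists_bound_of_continuousOn hh.continuousOn
  obtain ⟨C', hC'⟩ := exists_bound_of_continuousOn hh.deriv.continuousOn
  rw [mem_dirichlet_iff_lintegral (hd.fun_mul hf.1), lintegral_congr_disc
    (g := fun z => ‖deriv h z * f z + h z * deriv f z‖ₑ ^ 2)]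
  · refine lintegral_enorm_add_sq_lt_top (aemeasurable_area
      ((hd.deriv isOpen_disc).mul hf.1).continuousOn)
      (lintegral_enorm_mul_sq_lt_top hC' (lintegral_sq_lt_top hf))
      (lintegral_enorm_mul_sq_lt_top hC ((mem_dirichlet_iff_lintegral hf.1).1 hf))
  · intro z hz
    simp only
    rw [deriv_fun_mul (hd.differentiableAt (isOpen_disc.mem_nhds hz))
      (hf.1.differentiableAt (isOpen_disc.mem_nhds hz))]

/-- The Blaschke factor with zero `a`, an automorphism of the disc for `a ∈ disc`. -/
noncomputable def blaschkeFactor (a z : ℂ) : ℂ := (z - a) / (1 - conj a * z)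

lemma one_sub_conj_mul_ne_zero {a z : ℂ} (ha : a ∈ disc) (hz : ‖z‖ ≤ 1) :
    1 - conj a * z ≠ 0 := by
  intro h
  have h1 : conj a * z = 1 := (sub_eq_zero.1 h).symm
  have h2 : ‖a‖ * ‖z‖ = 1 := by simpa using congrArg norm h1
  have := mem_disc.1 ha
  nlinarith [norm_nonneg a, norm_nonneg z]

lemma normSq_sub_blaschke (a z : ℂ) :
    ‖1 - conj a * z‖ ^ 2 - ‖z - a‖ ^ 2 = (1 - ‖a‖ ^ 2) * (1 - ‖z‖ ^ 2) := by
  simp only [← Complex.normSq_eq_norm_sq, Complex.normSq_apply, sub_re, sub_im, mul_re, mul_im,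
    conj_re, conj_im, one_re, one_im]
  ring

lemma one_sub_norm_blaschkeFactor_sq {a z : ℂ} (ha : a ∈ disc) (hz : z ∈ disc) :
    1 - ‖blaschkeFactor a z‖ ^ 2 =
      (1 - ‖a‖ ^ 2) * (1 - ‖z‖ ^ 2) / ‖1 - conj a * z‖ ^ 2 := by
  have h := one_sub_conj_mul_ne_zero ha (mem_disc.1 hz).le
  have h' : ‖1 - conj a * z‖ ^ 2 ≠ 0 := by simpa using h
  rw [blaschkeFactor, norm_div, div_pow, ← normSq_sub_blaschke, sub_div, div_self h']

lemma blaschkeFactor_mem_disc {a z : ℂ} (ha : a ∈ disc) (hz : z ∈ disc) :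
    blaschkeFactor a z ∈ disc := by
  have h := one_sub_conj_mul_ne_zero ha (mem_disc.1 hz).le
  have h1 := one_sub_norm_blaschkeFactor_sq ha hz
  rw [mem_disc] at *
  have h2 : 0 < (1 - ‖a‖ ^ 2) * (1 - ‖z‖ ^ 2) / ‖1 - conj a * z‖ ^ 2 := by
    have : 0 < 1 - ‖a‖ ^ 2 := by nlinarith [norm_nonneg a]
    have : 0 < 1 - ‖z‖ ^ 2 := by nlinarith [norm_nonneg z]
    positivity
  nlinarith [norm_nonneg (blaschkeFactor a z)]

lemma neg_mem_disc {a : ℂ} (ha : a ∈ disc) : -a ∈ disc := by simpa [mem_disc] using ha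

lemma blaschkeFactor_neg_blaschkeFactor {a z : ℂ} (ha : a ∈ disc) (hz : z ∈ disc) :
    blaschkeFactor (-a) (blaschkeFactor a z) = z := by
  have h := one_sub_conj_mul_ne_zero ha (mem_disc.1 hz).le
  have h2 := one_sub_conj_mul_ne_zero ha (mem_disc.1 ha).le
  have h3 : 1 - conj a * z + conj a * (z - a) ≠ 0 := by convert h2 using 1; ring
  unfold blaschkeFactor
  have h4 : 1 - conj (-a) * ((z - a) / (1 - conj a * z)) =
      (1 - conj a * z + conj a * (z - a)) / (1 - conj a * z) := by
    rw [eq_div_iff h, map_neg, neg_mul, sub_neg_eq_add, add_mul, one_mul, mul_assoc,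
      div_mul_cancel₀ _ h]
  have h5 : (z - a) / (1 - conj a * z) - -a =
      (z - a + a * (1 - conj a * z)) / (1 - conj a * z) := by
    rw [eq_div_iff h, sub_neg_eq_add, add_mul, div_mul_cancel₀ _ h]
  rw [h4, h5, div_div_div_cancel_right₀ h, div_eq_iff h3]
  ring

lemma blaschkeFactor_analytic {a : ℂ} (ha : a ∈ disc) :
    AnalyticOnNhd ℂ (blaschkeFactor a) (Metric.closedBall 0 1) := by
  intro z hz
  have : 1 - conj a * z ≠ 0 := one_sub_conj_mul_ne_zero ha (by simpa using hz)
  unfold blaschkeFactor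
  fun_prop (disch := assumption)

lemma blaschkeFactor_differentiableOn {a : ℂ} (ha : a ∈ disc) :
    DifferentiableOn ℂ (blaschkeFactor a) disc :=
  (blaschkeFactor_analytic ha).differentiableOn.mono Metric.ball_subset_closedBall

lemma det_real_toSpanSingleton (c : ℂ) :
    ((ContinuousLinearMap.toSpanSingleton ℂ c).restrictScalars ℝ).det = ‖c‖ ^ 2 := by
  change LinearMap.det (((ContinuousLinearMap.toSpanSingleton ℂ c : ℂ →L[ℂ] ℂ) :
    ℂ →ₗ[ℂ] ℂ).restrictScalars ℝ) = _
  rw [LinearMap.det_restrictScalars]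
  simp [Complex.normSq_eq_norm_sq, Algebra.norm_complex_apply]

/-- The Dirichlet space is invariant under automorphisms of the disc. -/
lemma dirichlet_comp_blaschkeFactor {f : ℂ → ℂ} (hf : f ∈ dirichlet) {a : ℂ} (ha : a ∈ disc) :
    (fun z => f (blaschkeFactor a z)) ∈ dirichlet := by
  have hd := blaschkeFactor_differentiableOn ha
  have hm : Set.MapsTo (blaschkeFactor a) disc disc := fun z hz => blaschkeFactor_mem_disc ha hz
  have himg : blaschkeFactor a '' disc = disc := by
    refine Set.Subset.antisymm hm.image_subset fun w hw => ?_
    refine ⟨blaschkeFactor (-a) w, blaschkeFactor_mem_disc (neg_mem_disc ha) hw, ?_⟩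
    simpa using blaschkeFactor_neg_blaschkeFactor (neg_mem_disc ha) hw
  have hinj : Set.InjOn (blaschkeFactor a) disc := fun z hz w hw h => by
    rw [← blaschkeFactor_neg_blaschkeFactor ha hz, h, blaschkeFactor_neg_blaschkeFactor ha hw]
  have hda : ∀ z ∈ disc, HasDerivAt (blaschkeFactor a) (deriv (blaschkeFactor a) z) z :=
    fun z hz => (hd.differentiableAt (isOpen_disc.mem_nhds hz)).hasDerivAt
  -- the real Jacobian of a holomorphic map is the squared modulus of its derivative
  have hcov := lintegral_image_eq_lintegral_abs_det_fderiv_mul volume isOpen_disc.measurableSet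
    (fun z hz => ((hda z hz).hasFDerivAt.restrictScalars ℝ).hasFDerivWithinAt) hinj
    fun w => ‖deriv f w‖ₑ ^ 2
  rw [mem_dirichlet_iff_lintegral (f := fun z => f (blaschkeFactor a z)) (hf.1.comp hd hm)]
  have hfin := (mem_dirichlet_iff_lintegral hf.1).1 hf
  rw [lintegral_area, ← himg, hcov] at hfin
  rw [lintegral_area]
  convert! hfin using 2
  refine setLIntegral_congr_fun isOpen_disc.measurableSet fun z hz => ?_
  have h1 : HasDerivAt (fun z => f (blaschkeFactor a z))
      (deriv f (blaschkeFactor a z) * deriv (blaschkeFactor a) z) z :=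
    ((hf.1.differentiableAt (isOpen_disc.mem_nhds (hm hz))).hasDerivAt).comp z (hda z hz)
  rw [h1.deriv, enorm_mul, mul_pow, mul_comm]
  congr 1
  have h2 := det_real_toSpanSingleton (deriv (blaschkeFactor a) z)
  erw [h2]
  rw [abs_of_nonneg (by positivity), ENNReal.ofReal_pow (norm_nonneg _), ofReal_norm]

/-! ### Finite Blaschke products and boundary behaviour -/

/-- The filter of points of the disc approaching the unit circle. -/
noncomputable def boundary : Filter ℂ := comap (fun z : ℂ => ‖z‖) (𝓝[<] 1)

/-- A function whose modulus tends to one, uniformly, at the unit circle. -/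
def UnimodularAtBoundary (g : ℂ → ℂ) : Prop := Tendsto (fun z => ‖g z‖) boundary (𝓝 1)

lemma eventually_boundary {p : ℂ → Prop} :
    (∀ᶠ z in boundary, p z) ↔ ∃ r : ℝ, r < 1 ∧ ∀ z : ℂ, r < ‖z‖ → ‖z‖ < 1 → p z := by
  rw [boundary, eventually_comap]
  constructor
  · intro h
    obtain ⟨r, hr, h⟩ := (mem_nhdsLT_iff_exists_Ioo_subset).1 h
    exact ⟨r, hr, fun z h1 h2 => h ⟨h1, h2⟩ z rfl⟩
  · rintro ⟨r, hr, h⟩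
    filter_upwards [Ioo_mem_nhdsLT hr] with b hb z hz
    exact h z (hz ▸ hb.1) (hz ▸ hb.2)

lemma eventually_boundary_mem_disc : ∀ᶠ z in boundary, z ∈ disc :=
  eventually_boundary.2 ⟨0, one_pos, fun _ _ h => mem_disc.2 h⟩

lemma tendsto_norm_boundary : Tendsto (fun z : ℂ => ‖z‖) boundary (𝓝 1) :=
  tendsto_comap.mono_right nhdsWithin_le_nhds

lemma unimodularAtBoundary_blaschkeFactor {a : ℂ} (ha : a ∈ disc) :
    UnimodularAtBoundary (blaschkeFactor a) := by
  have h1 : Tendsto (fun z => 1 - ‖blaschkeFactor a z‖ ^ 2) boundary (𝓝 0) := by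
    have h2 : Tendsto (fun z : ℂ => (1 - ‖a‖ ^ 2) * (1 - ‖z‖ ^ 2) / (1 - ‖a‖) ^ 2) boundary
        (𝓝 0) := by
      have := (((tendsto_norm_boundary.pow 2).const_sub 1).const_mul (1 - ‖a‖ ^ 2)).div_const
        ((1 - ‖a‖) ^ 2)
      simpa using this
    refine squeeze_zero' ?_ ?_ h2
    · filter_upwards [eventually_boundary_mem_disc] with z hz
      have := mem_disc.1 (blaschkeFactor_mem_disc ha hz)
      nlinarith [norm_nonneg (blaschkeFactor a z)]
    · filter_upwards [eventually_boundary_mem_disc] with z hz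
      rw [one_sub_norm_blaschkeFactor_sq ha hz]
      rw [mem_disc] at ha hz
      have h3 : 1 - ‖a‖ ≤ ‖1 - conj a * z‖ := by
        have := norm_sub_norm_le 1 (conj a * z)
        simp only [norm_one, norm_mul, RCLike.norm_conj] at this
        nlinarith [norm_nonneg a, norm_nonneg z]
      have h4 : 0 < 1 - ‖a‖ := by linarith
      have h5 : 0 ≤ (1 - ‖a‖ ^ 2) * (1 - ‖z‖ ^ 2) :=
        mul_nonneg (by nlinarith [norm_nonneg a]) (by nlinarith [norm_nonneg z])
      gcongr
  have h3 := (h1.const_sub 1).sqrt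
  simpa [UnimodularAtBoundary, Real.sqrt_sq] using h3

lemma UnimodularAtBoundary.tendsto_boundary {g : ℂ → ℂ} (hg : UnimodularAtBoundary g)
    (hm : Set.MapsTo g disc disc) : Tendsto g boundary boundary := by
  rw [boundary, tendsto_comap_iff, ← boundary]
  refine tendsto_nhdsWithin_iff.2 ⟨hg, ?_⟩
  filter_upwards [eventually_boundary_mem_disc] with z hz using mem_disc.1 (hm hz)

/-- The maximum principle on discs of radius tending to one. -/
lemma UnimodularAtBoundary.norm_le_one {g : ℂ → ℂ} (hg : UnimodularAtBoundary g)
    (hd : DifferentiableOn ℂ g disc) {z : ℂ} (hz : z ∈ disc) : ‖g z‖ ≤ 1 := by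
  refine le_of_forall_pos_le_add fun ε hε => ?_
  obtain ⟨r, hr, h⟩ := eventually_boundary.1
    (hg.eventually_lt_const (show (1 : ℝ) < 1 + ε by linarith))
  obtain ⟨R, hR, hR1⟩ := exists_between (max_lt hr (max_lt (mem_disc.1 hz) zero_lt_one))
  simp only [max_lt_iff] at hR
  have hsub : Metric.closedBall (0 : ℂ) R ⊆ disc := Metric.closedBall_subset_ball hR1
  refine Complex.norm_le_of_forall_mem_frontier_norm_le (U := Metric.ball 0 R)
    Metric.isBounded_ball ?_ (fun w hw => ?_) (subset_closure (by simpa using hR.2.1))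
  · refine DifferentiableOn.diffContOnCl ?_
    rw [closure_ball _ hR.2.2.ne']
    exact hd.mono hsub
  · rw [frontier_ball _ hR.2.2.ne', mem_sphere_zero_iff_norm] at hw
    exact (h w (hw ▸ hR.1) (hw ▸ hR1)).le

/-- A zero-free function of modulus one at the boundary is constant: both it and its inverse are
bounded by one. -/
lemma UnimodularAtBoundary.eq_const {g : ℂ → ℂ} (hg : UnimodularAtBoundary g)
    (hd : DifferentiableOn ℂ g disc) (h0 : ∀ z ∈ disc, g z ≠ 0) :
    ∃ c : ℂ, ‖c‖ = 1 ∧ ∀ z ∈ disc, g z = c := by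
  have hinv : UnimodularAtBoundary fun z => (g z)⁻¹ := by
    have := hg.inv₀ one_ne_zero
    simpa [UnimodularAtBoundary] using this
  have h1 : ∀ z ∈ disc, ‖g z‖ = 1 := fun z hz => by
    refine le_antisymm (hg.norm_le_one hd hz) ?_
    have := hinv.norm_le_one (hd.inv h0) hz
    rw [norm_inv] at this
    exact (inv_le_one₀ (norm_pos_iff.2 (h0 z hz))).1 this
  refine ⟨g 0, h1 0 zero_mem_disc, fun z hz => ?_⟩
  refine Complex.eqOn_of_isPreconnected_of_isMaxOn_norm (U := disc)
    (convex_ball (0 : ℂ) 1).isPreconnected isOpen_disc hd zero_mem_disc (fun w hw => ?_) hz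
  simp [h1 w hw, h1 0 zero_mem_disc]

/-- A zero of a function analytic on the disc may be divided out by a Blaschke factor. -/
lemma exists_blaschkeFactor_mul {g : ℂ → ℂ} (hd : DifferentiableOn ℂ g disc) {a : ℂ}
    (ha : a ∈ disc) (hga : g a = 0) :
    ∃ g₁ : ℂ → ℂ, DifferentiableOn ℂ g₁ disc ∧ ∀ z ∈ disc, g z = blaschkeFactor a z * g₁ z := by
  refine ⟨fun z => (1 - conj a * z) * dslope g a z, ?_, fun z hz => ?_⟩
  · refine DifferentiableOn.mul (by fun_prop) ?_
    exact (Complex.differentiableOn_dslope (isOpen_disc.mem_nhds ha)).2 hd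
  · have h := one_sub_conj_mul_ne_zero ha (mem_disc.1 hz).le
    have h2 := sub_smul_dslope g a z
    rw [hga, sub_zero, smul_eq_mul] at h2
    rw [blaschkeFactor, ← h2, div_mul_eq_mul_div, eq_div_iff h]
    ring

/-- The induction on the number of zeros behind
`UnimodularAtBoundary.isFiniteBlaschkeProduct`. The power
`ρ ^ n` bounds the number of zeros that can be divided out before the value at `z₀` would
exceed one. -/
lemma UnimodularAtBoundary.isFiniteBlaschkeProduct_aux {z₀ : ℂ} (hz₀ : z₀ ∈ disc) {ρ r₀ : ℝ}
    (hρ : 0 < ρ) (hb : ∀ a ∈ disc, ‖a‖ ≤ r₀ → ‖blaschkeFactor a z₀‖ ≤ ρ) (n : ℕ) :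
    ∀ g : ℂ → ℂ, UnimodularAtBoundary g → DifferentiableOn ℂ g disc →
      (∀ z ∈ disc, g z = 0 → ‖z‖ ≤ r₀) → ρ ^ n < ‖g z₀‖ → IsFiniteBlaschkeProduct g := by
  induction n with
  | zero =>
    intro g hg hd _ h
    exact absurd (hg.norm_le_one hd hz₀) (by simpa using h)
  | succ n ih =>
    intro g hg hd hz h
    by_cases h0 : ∀ z ∈ disc, g z ≠ 0
    · obtain ⟨c, hc, h⟩ := hg.eq_const hd h0
      exact ⟨0, c, Fin.elim0, hc, fun i => i.elim0, fun z hz => by simpa using h z hz⟩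
    · push Not at h0
      obtain ⟨a, ha, hga⟩ := h0
      obtain ⟨g₁, hd₁, hg₁⟩ := exists_blaschkeFactor_mul hd ha hga
      have hu : UnimodularAtBoundary g₁ := by
        have := hg.div (unimodularAtBoundary_blaschkeFactor ha) one_ne_zero
        rw [div_one] at this
        refine this.congr' ?_
        have hne : ∀ᶠ z in boundary, ‖blaschkeFactor a z‖ ≠ 0 :=
          (unimodularAtBoundary_blaschkeFactor ha).eventually_ne one_ne_zero
        filter_upwards [eventually_boundary_mem_disc, hne] with z hz h
        rw [Pi.div_apply, hg₁ z hz, norm_mul, mul_div_cancel_left₀ _ h]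
      obtain ⟨k, c, b, hc, hbd, hk⟩ := ih g₁ hu hd₁
        (fun z hzd h0 => hz z hzd (by rw [hg₁ z hzd, h0, mul_zero])) (by
          rw [hg₁ z₀ hz₀, norm_mul, pow_succ'] at h
          by_contra! hcon
          have := mul_le_mul (hb a ha (hz a ha hga)) hcon (norm_nonneg _) hρ.le
          linarith)
      refine ⟨k + 1, c, Fin.cons a b, hc, fun i => ?_, fun z hz => ?_⟩
      · refine Fin.cases ?_ (fun j => ?_) i
        · simpa using ha
        · simpa using hbd j
      · rw [hg₁ z hz, hk z hz, Fin.prod_univ_succ]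
        simp only [Fin.cons_zero, Fin.cons_succ, blaschkeFactor]
        ring

/-- An analytic function of modulus one at the boundary is a finite Blaschke product. -/
lemma UnimodularAtBoundary.isFiniteBlaschkeProduct {g : ℂ → ℂ} (hg : UnimodularAtBoundary g)
    (hd : DifferentiableOn ℂ g disc) : IsFiniteBlaschkeProduct g := by
  obtain ⟨r₀, hr₀, hz⟩ := eventually_boundary.1 (hg.eventually_ne one_ne_zero)
  obtain ⟨t, ht, ht1⟩ := exists_between (max_lt hr₀ zero_lt_one)
  obtain ⟨hrt, ht0⟩ := max_lt_iff.1 ht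
  have htn : ‖(t : ℂ)‖ = t := by simp [abs_of_pos ht0]
  have htd : (t : ℂ) ∈ disc := by rw [mem_disc, htn]; exact ht1
  have hgt : 0 < ‖g t‖ := (norm_nonneg _).lt_of_ne'
    (hz t (by rw [htn]; exact hrt) (by rw [htn]; exact ht1))
  obtain ⟨R, hR, hR1⟩ := exists_between (max_lt hr₀ zero_lt_one)
  obtain ⟨hrR, hR0⟩ := max_lt_iff.1 hR
  -- all zeros lie in the ball of radius `R`, and `|b_a(t)|² ≤ 1 - δ` for `a` in that ball
  set δ : ℝ := (1 - R ^ 2) * (1 - t ^ 2) / 4 with hδ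
  have hRp : 0 < 1 - R ^ 2 := by nlinarith
  have htp : 0 < 1 - t ^ 2 := by nlinarith
  have hδ0 : 0 < δ := by positivity
  have hδ1 : δ < 1 := by
    have : (1 - R ^ 2) * (1 - t ^ 2) < 1 * 1 :=
      mul_lt_mul'' (by nlinarith) (by nlinarith) hRp.le htp.le
    rw [hδ]; linarith
  have hρ1 : √(1 - δ) < 1 := by rw [Real.sqrt_lt' one_pos]; linarith
  obtain ⟨n, hn⟩ := exists_pow_lt_of_lt_one hgt hρ1
  refine UnimodularAtBoundary.isFiniteBlaschkeProduct_aux htd (r₀ := R)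
    (Real.sqrt_pos.2 (by linarith)) (fun a ha haR => ?_) n g hg hd (fun z hzd h0 => ?_) hn
  · refine Real.le_sqrt_of_sq_le ?_
    have h1 := one_sub_norm_blaschkeFactor_sq ha htd
    have h2 : δ ≤ (1 - ‖a‖ ^ 2) * (1 - ‖(t : ℂ)‖ ^ 2) / ‖1 - conj a * t‖ ^ 2 := by
      have h3 : ‖1 - conj a * t‖ ≤ 2 := by
        refine (norm_sub_le _ _).trans ?_
        rw [norm_one, norm_mul, RCLike.norm_conj, htn]
        nlinarith [mem_disc.1 ha, norm_nonneg a]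
      have h4 : 0 < ‖1 - conj a * t‖ :=
        norm_pos_iff.2 (one_sub_conj_mul_ne_zero ha (mem_disc.1 htd).le)
      have h5 : ‖1 - conj a * t‖ ^ 2 ≤ 4 := by nlinarith
      rw [htn, hδ]
      have h6 : 1 - R ^ 2 ≤ 1 - ‖a‖ ^ 2 := by nlinarith [norm_nonneg a]
      have h7 := hRp.le.trans h6
      gcongr
    linarith
  · by_contra! hlt
    exact hz z (hrR.trans hlt) (mem_disc.1 hzd) (by simp [h0])

lemma IsFiniteBlaschkeProduct.unimodularAtBoundary {g : ℂ → ℂ} (h : IsFiniteBlaschkeProduct g) :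
    UnimodularAtBoundary g := by
  obtain ⟨n, c, a, hc, ha, hg⟩ := h
  have h1 : Tendsto (fun z => ∏ i, ‖blaschkeFactor (a i) z‖) boundary (𝓝 (∏ _i : Fin n, 1)) :=
    tendsto_finsetProd _ fun i _ => unimodularAtBoundary_blaschkeFactor (ha i)
  rw [Finset.prod_const_one] at h1
  refine h1.congr' ?_
  filter_upwards [eventually_boundary_mem_disc] with z hz
  rw [hg z hz, norm_mul, hc, one_mul, norm_prod]
  rfl

/-! ### The Hardy space of square-summable Taylor coefficients -/

/-- The Hardy space `H²`, realized as the Hilbert space of square-summable Taylor coefficients. -/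
abbrev Hardy : Type := lp (fun _ : ℕ => ℂ) 2

lemma Hardy.hasSum_sq (x : Hardy) : HasSum (fun n => ‖x n‖ ^ 2) (‖x‖ ^ 2) := by
  have := lp.hasSum_norm (p := 2) (by norm_num) x
  simpa using this

lemma memℓp_two {a : ℕ → ℂ} (h : Summable fun n => ‖a n‖ ^ 2) : Memℓp a 2 :=
  memℓp_gen (by simpa using h)

lemma exists_hardy {a : ℕ → ℂ} (h : Summable fun n => ‖a n‖ ^ 2) : ∃ x : Hardy, ∀ n, x n = a n :=
  ⟨⟨a, memℓp_two h⟩, fun _ => rfl⟩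

/-- Prepend a zero to a sequence. -/
def prependZero (a : ℕ → ℂ) : ℕ → ℂ
  | 0 => 0
  | n + 1 => a n

lemma hasSum_prependZero_sq (x : Hardy) :
    HasSum (fun n => ‖prependZero x n‖ ^ 2) (‖x‖ ^ 2) := by
  refine (hasSum_nat_add_iff' 1).1 ?_
  simpa [prependZero] using x.hasSum_sq

/-- Multiplication by the coordinate function on the Hardy space: the unilateral shift. -/
noncomputable def shift : Hardy →ₗᵢ[ℂ] Hardy where
  toFun x := ⟨prependZero x, memℓp_two (hasSum_prependZero_sq x).summable⟩
  map_add' x y := by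
    ext n
    change prependZero (x + y : Hardy) n = prependZero x n + prependZero y n
    cases n <;> simp [prependZero]
  map_smul' c x := by ext n; cases n <;> simp [prependZero]
  norm_map' x := by
    refine (sq_eq_sq₀ (norm_nonneg _) (norm_nonneg _)).1 ?_
    exact (Hardy.hasSum_sq _).unique (hasSum_prependZero_sq x)

/-- The unilateral shift as an operator. -/
noncomputable def S : Hardy →L[ℂ] Hardy := shift.toContinuousLinearMap

/-- The backward shift, the adjoint of the unilateral shift. -/
noncomputable def B : Hardy →L[ℂ] Hardy := ContinuousLinearMap.adjoint S

@[simp] lemma S_apply_zero (x : Hardy) : S x 0 = 0 := rfl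

@[simp] lemma S_apply_succ (x : Hardy) (n : ℕ) : S x (n + 1) = x n := rfl

@[simp] lemma norm_S (x : Hardy) : ‖S x‖ = ‖x‖ := shift.norm_map x

/-- The monomials, an orthonormal basis of the Hardy space. -/
noncomputable def mono (n : ℕ) : Hardy := lp.single 2 n 1

lemma mono_apply (n k : ℕ) : mono n k = if k = n then 1 else 0 := by
  simp [mono, Pi.single_apply]

lemma inner_mono (n : ℕ) (x : Hardy) : inner ℂ (mono n) x = x n := by
  simp [mono, lp.inner_single_left]

lemma S_mono (n : ℕ) : S (mono n) = mono (n + 1) := by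
  ext k; cases k <;> simp [mono_apply]

@[simp] lemma B_apply (x : Hardy) (n : ℕ) : B x n = x (n + 1) := by
  rw [← inner_mono, B, ContinuousLinearMap.adjoint_inner_right, S_mono, inner_mono]

lemma B_S (x : Hardy) : B (S x) = x := by ext n; simp

lemma B_pow_apply (m : ℕ) (x : Hardy) (n : ℕ) : (B ^ m) x n = x (n + m) := by
  induction m generalizing n with
  | zero => simp
  | succ m ih => rw [pow_succ', mul_apply_eq_comp, B_apply, ih, add_right_comm, add_assoc]

lemma norm_B_pow_sq (m : ℕ) (x : Hardy) :
    HasSum (fun n => ‖x (n + m)‖ ^ 2) (‖(B ^ m) x‖ ^ 2) := by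
  simpa only [B_pow_apply] using ((B ^ m) x).hasSum_sq

/-- The reproducing kernel of the Hardy space at `z`; for `z` outside the disc, where
the powers are not square-summable, it is set to zero. -/
noncomputable def kern (z : ℂ) : Hardy :=
  open Classical in if h : Memℓp (fun n : ℕ => conj z ^ n) 2 then ⟨_, h⟩ else 0

lemma hasSum_geometric_sq {z : ℂ} (hz : z ∈ disc) :
    HasSum (fun n : ℕ => ‖conj z ^ n‖ ^ 2) (1 - ‖z‖ ^ 2)⁻¹ := by
  have h : ‖z‖ ^ 2 < 1 := by have := mem_disc.1 hz; nlinarith [norm_nonneg z]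
  convert! hasSum_geometric_of_lt_one (sq_nonneg ‖z‖) h using 2 with n
  rw [norm_pow, RCLike.norm_conj, ← pow_mul, ← pow_mul, mul_comm]

lemma kern_apply {z : ℂ} (hz : z ∈ disc) (n : ℕ) : kern z n = conj z ^ n := by
  rw [kern, dif_pos (memℓp_two (hasSum_geometric_sq hz).summable)]

lemma norm_kern_sq {z : ℂ} (hz : z ∈ disc) : ‖kern z‖ ^ 2 = (1 - ‖z‖ ^ 2)⁻¹ := by
  refine (Hardy.hasSum_sq _).unique ?_
  simpa only [kern_apply hz] using hasSum_geometric_sq hz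

/-- The value at `z` of an element of the Hardy space. -/
noncomputable def ev (z : ℂ) : Hardy →L[ℂ] ℂ := innerSL ℂ (kern z)

lemma ev_eq_inner (z : ℂ) (x : Hardy) : ev z x = inner ℂ (kern z) x := rfl

lemma isTaylor_ev (x : Hardy) : IsTaylor x (fun z => ev z x) := by
  intro z hz
  have := lp.hasSum_inner (𝕜 := ℂ) (kern z) x
  simpa [kern_apply hz, ev_eq_inner] using this

lemma ev_S {z : ℂ} (hz : z ∈ disc) (x : Hardy) : ev z (S x) = z * ev z x := by
  refine (isTaylor_ev (S x) z hz).unique ?_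
  refine (hasSum_nat_add_iff' 1).1 ?_
  simpa [pow_succ, mul_assoc, mul_comm, mul_left_comm] using (isTaylor_ev x z hz).mul_left z

lemma ev_kern {a z : ℂ} (ha : a ∈ disc) (hz : z ∈ disc) :
    ev z (kern a) = (1 - conj a * z)⁻¹ := by
  refine (isTaylor_ev (kern a) z hz).unique ?_
  simp only [kern_apply ha, ← mul_pow]
  refine hasSum_geometric_of_norm_lt_one ?_
  rw [norm_mul, RCLike.norm_conj]
  have := mem_disc.1 ha
  have := mem_disc.1 hz
  nlinarith [norm_nonneg a, norm_nonneg z]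

lemma ev_mono_zero {z : ℂ} (hz : z ∈ disc) : ev z (mono 0) = 1 := by
  refine (isTaylor_ev (mono 0) z hz).unique ?_
  convert hasSum_ite_eq 0 (1 : ℂ) using 2 with n
  rcases n with _ | n <;> simp [mono_apply]

lemma Hardy.ext_ev {x y : Hardy} (h : ∀ z ∈ disc, ev z x = ev z y) : x = y := by
  have := (isTaylor_ev x).unique ((isTaylor_ev y).congr fun z hz => (h z hz).symm)
  exact lp.ext this

/-- The Dirichlet integral of an element of the Hardy space, as a sum over the powers of the
backward shift. -/
lemma tsum_norm_B_pow_sq (x : Hardy) :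
    ∑' m : ℕ, ENNReal.ofReal (‖(B ^ (m + 1)) x‖ ^ 2) =
      ∑' n : ℕ, ENNReal.ofReal (n * ‖x n‖ ^ 2) := by
  have h1 : ∀ m : ℕ, ENNReal.ofReal (‖(B ^ (m + 1)) x‖ ^ 2) =
      ∑' k : ℕ, ENNReal.ofReal (‖x (k + (m + 1))‖ ^ 2) := fun m => by
    rw [← (norm_B_pow_sq (m + 1) x).tsum_eq]
    exact ENNReal.ofReal_tsum_of_nonneg (fun _ => by positivity) (norm_B_pow_sq (m + 1) x).summable
  simp_rw [h1]
  rw [← ENNReal.tsum_prod (f := fun m k => ENNReal.ofReal (‖x (k + (m + 1))‖ ^ 2)),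
    ← Finset.HasAntidiagonal.sigmaAntidiagonalEquivProd.tsum_eq, ENNReal.tsum_sigma']
  rw [tsum_eq_zero_add' (f := fun n : ℕ => ENNReal.ofReal (n * ‖x n‖ ^ 2)) ENNReal.summable]
  simp only [Nat.cast_zero, zero_mul, ENNReal.ofReal_zero, zero_add]
  congr 1; ext n
  have h2 : ∀ p : Finset.HasAntidiagonal.antidiagonal n, ENNReal.ofReal
      (‖x (((Finset.HasAntidiagonal.sigmaAntidiagonalEquivProd ⟨n, p⟩ : ℕ × ℕ)).2 +
        (((Finset.HasAntidiagonal.sigmaAntidiagonalEquivProd ⟨n, p⟩ : ℕ × ℕ)).1 + 1))‖ ^ 2) =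
      ENNReal.ofReal (‖x (n + 1)‖ ^ 2) := fun p => by
    have := Finset.HasAntidiagonal.mem_antidiagonal.1 p.2
    simp only [Finset.HasAntidiagonal.sigmaAntidiagonalEquivProd_apply]
    rw [show (p : ℕ × ℕ).2 + ((p : ℕ × ℕ).1 + 1) = n + 1 by omega]
  rw [tsum_congr h2, tsum_fintype, Finset.sum_const, Finset.card_univ, Fintype.card_coe,
    Finset.Nat.card_antidiagonal, nsmul_eq_mul, ENNReal.ofReal_mul (by positivity)]
  congr 1
  rw [ENNReal.ofReal_natCast]

/-- The partial sums of the Dirichlet integral expressed through the backward shift. -/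
noncomputable def energy (M : ℕ) (x : Hardy) : ℝ := ∑ m ∈ Finset.range M, ‖(B ^ (m + 1)) x‖ ^ 2

lemma summable_iff_energy_bounded (x : Hardy) :
    (Summable fun n : ℕ => (n : ℝ) * ‖x n‖ ^ 2) ↔ ∃ C, ∀ M, energy M x ≤ C := by
  have h := tsum_norm_B_pow_sq x
  have key : (Summable fun n : ℕ => (n : ℝ) * ‖x n‖ ^ 2) ↔
      Summable fun m : ℕ => ‖(B ^ (m + 1)) x‖ ^ 2 := by
    have aux : ∀ f : ℕ → ℝ, (∀ n, 0 ≤ f n) →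
        (Summable f ↔ ∑' n, ENNReal.ofReal (f n) ≠ ∞) := fun f hf =>
      ⟨fun hs => hs.tsum_ofReal_lt_top.ne, fun hs =>
        (ENNReal.summable_toReal hs).congr fun n => ENNReal.toReal_ofReal (hf n)⟩
    rw [aux _ fun n => by positivity, aux _ fun n => by positivity, h]
  rw [key]
  refine ⟨fun hs => ⟨_, fun M => hs.sum_le_tsum _ fun _ _ => by positivity⟩, fun ⟨C, hC⟩ => ?_⟩
  exact summable_of_sum_range_le (fun _ => by positivity) hC

lemma hardy_mem_dirichlet_iff (x : Hardy) :
    (fun z => ev z x) ∈ dirichlet ↔ ∃ C, ∀ M, energy M x ≤ C :=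
  (isTaylor_ev x).mem_dirichlet_iff.trans (summable_iff_energy_bounded x)

lemma exists_hardy_of_mem_dirichlet {f : ℂ → ℂ} (hf : f ∈ dirichlet) :
    ∃ x : Hardy, ∀ z ∈ disc, f z = ev z x := by
  obtain ⟨a, ha, hs⟩ := dirichlet_exists_isTaylor hf
  obtain ⟨x, hx⟩ := exists_hardy (summable_sq_of_summable_mul_sq hs)
  refine ⟨x, fun z hz => (ha z hz).unique ?_⟩
  simpa [hx] using isTaylor_ev x z hz

/-! ### Multiplication by a finite Blaschke product as an operator -/

/-- The operator `W` on the Hardy space acts as multiplication by the inner function `g`, which is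
analytic across the circle; it increases the Dirichlet integral by at most a multiple of the
squared Hardy norm, and its range has a finite-dimensional complement spanned by functions
analytic across the circle. Finite Blaschke products have this property. -/
structure IsModelOperator (W : Hardy →L[ℂ] Hardy) (g : ℂ → ℂ) : Prop where
  analytic : AnalyticOnNhd ℂ g (Metric.closedBall 0 1)
  norm_map : ∀ x, ‖W x‖ = ‖x‖
  commute : Commute W S
  ev_apply : ∀ z ∈ disc, ∀ x, ev z (W x) = g z * ev z x
  energy_le : ∃ C : ℝ, 0 ≤ C ∧ ∀ M x, energy M (W x) ≤ energy M x + C * ‖x‖ ^ 2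
  defect : ∃ (ι : Type) (_ : Fintype ι) (e : ι → Hardy) (h : ι → ℂ → ℂ) (c : ι → Hardy →L[ℂ] ℂ),
    (∀ i, AnalyticOnNhd ℂ (h i) (Metric.closedBall 0 1)) ∧
    (∀ i, ∀ z ∈ disc, ev z (e i) = h i z) ∧ ∀ x, x - W (adjoint W x) = ∑ i, c i x • e i

lemma adjoint_apply_apply {W : Hardy →L[ℂ] Hardy} (h : ∀ x, ‖W x‖ = ‖x‖) (x : Hardy) :
    adjoint W (W x) = x := by
  have := (ContinuousLinearMap.norm_map_iff_adjoint_comp_self W).1 h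
  exact congrArg (fun T : Hardy →L[ℂ] Hardy => T x) this

lemma norm_le_of_isometry {W : Hardy →L[ℂ] Hardy} (h : ∀ x, ‖W x‖ = ‖x‖) : ‖W‖ ≤ 1 :=
  W.opNorm_le_bound zero_le_one fun x => by rw [h, one_mul]

lemma norm_adjoint_apply_le {W : Hardy →L[ℂ] Hardy} (h : ∀ x, ‖W x‖ = ‖x‖) (x : Hardy) :
    ‖adjoint W x‖ ≤ ‖x‖ := by
  refine (adjoint W).le_of_opNorm_le ?_ x |>.trans (one_mul _).le
  rw [LinearIsometryEquiv.norm_map]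
  exact norm_le_of_isometry h

lemma norm_sq_eq_adjoint {W : Hardy →L[ℂ] Hardy} (h : ∀ x, ‖W x‖ = ‖x‖) (x : Hardy) :
    ‖x‖ ^ 2 = ‖adjoint W x‖ ^ 2 + ‖x - W (adjoint W x)‖ ^ 2 := by
  have h1 : inner ℂ (W (adjoint W x)) (x - W (adjoint W x)) = 0 := by
    rw [← ContinuousLinearMap.adjoint_inner_right, map_sub, adjoint_apply_apply h, sub_self,
      inner_zero_right]
  have := norm_add_sq_eq_norm_sq_add_norm_sq_of_inner_eq_zero _ _ h1
  rw [add_sub_cancel, h] at this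
  simpa [sq] using this

lemma energy_smul (M : ℕ) (c : ℂ) (x : Hardy) : energy M (c • x) = ‖c‖ ^ 2 * energy M x := by
  simp only [energy, map_smul, norm_smul, mul_pow, Finset.mul_sum]

lemma isModelOperator_const {c : ℂ} (hc : ‖c‖ = 1) :
    IsModelOperator (c • ContinuousLinearMap.id ℂ Hardy) fun _ => c where
  analytic := analyticOnNhd_const
  norm_map x := by simp [norm_smul, hc]
  commute := by ext x : 1; simp [mul_apply_eq_comp]
  ev_apply z _ x := by simp
  energy_le := ⟨0, le_rfl, fun M x => by simp [energy_smul, hc]⟩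
  defect := by
    refine ⟨Empty, inferInstance, Empty.elim, Empty.elim, Empty.elim, fun i => i.elim,
      fun i => i.elim, fun x => ?_⟩
    have : c * conj c = 1 := by rw [Complex.mul_conj, Complex.normSq_eq_norm_sq, hc]; simp
    have h := adjoint_apply_apply (W := c • ContinuousLinearMap.id ℂ Hardy)
      (fun x => by simp [norm_smul, hc]) (conj c • x)
    simp only [smul_apply, ContinuousLinearMap.id_apply, smul_smul, this,
      one_smul] at h
    have this' : conj c * c = 1 := by rw [mul_comm, this]
    simp [h, smul_smul, this']

lemma IsModelOperator.comp {W₁ W₂ : Hardy →L[ℂ] Hardy} {g₁ g₂ : ℂ → ℂ}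
    (h₁ : IsModelOperator W₁ g₁) (h₂ : IsModelOperator W₂ g₂) :
    IsModelOperator (W₁ * W₂) fun z => g₁ z * g₂ z where
  analytic := h₁.analytic.mul h₂.analytic
  norm_map x := by rw [mul_apply_eq_comp, h₁.norm_map, h₂.norm_map]
  commute := h₁.commute.mul_left h₂.commute
  ev_apply z hz x := by rw [mul_apply_eq_comp, h₁.ev_apply z hz, h₂.ev_apply z hz, mul_assoc]
  energy_le := by
    obtain ⟨C₁, h0₁, hC₁⟩ := h₁.energy_le
    obtain ⟨C₂, h0₂, hC₂⟩ := h₂.energy_le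
    refine ⟨C₁ + C₂, by positivity, fun M x => ?_⟩
    rw [mul_apply_eq_comp]
    have := hC₁ M (W₂ x)
    have := hC₂ M x
    rw [h₂.norm_map] at *
    linarith
  defect := by
    obtain ⟨ι₁, _, e₁, f₁, c₁, ha₁, he₁, hd₁⟩ := h₁.defect
    obtain ⟨ι₂, _, e₂, f₂, c₂, ha₂, he₂, hd₂⟩ := h₂.defect
    -- `1 - W₁ W₂ (W₁ W₂)† = (1 - W₁ W₁†) + W₁ (1 - W₂ W₂†) W₁†`
    refine ⟨ι₁ ⊕ ι₂, inferInstance, Sum.elim e₁ fun i => W₁ (e₂ i),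
      Sum.elim f₁ fun i z => g₁ z * f₂ i z,
      Sum.elim c₁ fun i => (c₂ i).comp (adjoint W₁), ?_, ?_, ?_⟩
    · rintro (i | i)
      · exact ha₁ i
      · exact h₁.analytic.mul (ha₂ i)
    · rintro (i | i) z hz
      · exact he₁ i z hz
      · simp only [Sum.elim_inr]
        rw [h₁.ev_apply z hz, he₂ i z hz]
    · intro x
      have hadj : adjoint (W₁ * W₂) x = adjoint W₂ (adjoint W₁ x) := by
        rw [ContinuousLinearMap.mul_def, ContinuousLinearMap.adjoint_comp]; rfl
      simp only [Fintype.sum_sum_type, Sum.elim_inl, Sum.elim_inr, ContinuousLinearMap.comp_apply]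
      rw [← hd₁, hadj, mul_apply_eq_comp]
      simp_rw [← map_smul]
      rw [← map_sum, ← hd₂, map_sub]
      abel

/-- The identity behind the isometry of Blaschke factors, for the Hardy norm as well as for the
Dirichlet integral. -/
lemma norm_sub_smul_sq_sub (a : ℂ) (u v : Hardy) :
    ‖u - a • v‖ ^ 2 - ‖v - conj a • u‖ ^ 2 = (1 - ‖a‖ ^ 2) * (‖u‖ ^ 2 - ‖v‖ ^ 2) := by
  have h : (inner ℂ v (conj a • u)).re = (inner ℂ u (a • v)).re := by
    rw [inner_smul_right, inner_smul_right, ← inner_conj_symm v u, ← map_mul, Complex.conj_re]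
  have h1 := norm_sub_sq (𝕜 := ℂ) u (a • v)
  have h2 := norm_sub_sq (𝕜 := ℂ) v (conj a • u)
  simp only [RCLike.re_eq_complex_re] at h1 h2
  rw [h1, h2, h, norm_smul, norm_smul, RCLike.norm_conj]
  ring

lemma norm_S_le : ‖S‖ ≤ 1 := norm_le_of_isometry norm_S

/-- Multiplication by a Blaschke factor is a model operator, namely `(S - a) (1 - ā S)⁻¹`. -/
lemma exists_isModelOperator_blaschkeFactor {a : ℂ} (ha : a ∈ disc) :
    ∃ W, IsModelOperator W (blaschkeFactor a) := by
  have ha1 := mem_disc.1 ha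
  have hn : ‖conj a • S‖ < 1 := by
    rw [norm_smul (conj a) S, RCLike.norm_conj]
    nlinarith [norm_S_le, norm_nonneg a, norm_nonneg S]
  let u := Units.oneSub (conj a • S) hn
  let R : Hardy →L[ℂ] Hardy := ↑u⁻¹
  have hu : (u : Hardy →L[ℂ] Hardy) = 1 - conj a • S := rfl
  have hRu : ∀ x, R x - conj a • S (R x) = x := fun x => by
    have : (u : Hardy →L[ℂ] Hardy) * R = 1 := u.mul_inv
    have := congrArg (fun T : Hardy →L[ℂ] Hardy => T x) this
    simpa [hu, mul_apply_eq_comp] using this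
  have huR : ∀ x, R (x - conj a • S x) = x := fun x => by
    have : R * (u : Hardy →L[ℂ] Hardy) = 1 := u.inv_mul
    have := congrArg (fun T : Hardy →L[ℂ] Hardy => T x) this
    simpa [hu, mul_apply_eq_comp] using this
  have hRS : Commute R S := by
    refine Commute.units_inv_left ?_
    rw [hu]
    exact (Commute.one_left S).sub_left ((Commute.refl S).smul_left _)
  have hT1 : Commute (S - a • (1 : Hardy →L[ℂ] Hardy)) S :=
    (Commute.refl S).sub_left ((Commute.one_left S).smul_left a)
  have hTx : ∀ x, ((S - a • (1 : Hardy →L[ℂ] Hardy)) * R) x = S (R x) - a • R x := fun x => by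
    simp [mul_apply_eq_comp]
  have hnorm : ∀ x, ‖((S - a • (1 : Hardy →L[ℂ] Hardy)) * R) x‖ = ‖x‖ := fun x => by
    have h1 := norm_sub_smul_sq_sub a (S (R x)) (R x)
    rw [hRu, norm_S, sub_self, mul_zero, ← hTx] at h1
    exact (sq_eq_sq₀ (norm_nonneg _) (norm_nonneg _)).1 (sub_eq_zero.1 h1)
  refine ⟨(S - a • 1) * R, blaschkeFactor_analytic ha, hnorm, hT1.mul_left hRS,
    fun z hz x => ?_, ⟨‖R‖ ^ 2, by positivity, fun M x => ?_⟩, ?_⟩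
  · have h1 := congrArg (ev z) (hRu x)
    rw [map_sub, map_smul, ev_S hz, smul_eq_mul] at h1
    have h2 := one_sub_conj_mul_ne_zero ha (mem_disc.1 hz).le
    rw [hTx, map_sub, map_smul, ev_S hz, smul_eq_mul, ← h1, blaschkeFactor, div_mul_eq_mul_div,
      eq_div_iff h2]
    ring
  · -- the differences of the terms telescope
    have h1 : ∀ m, ‖(B ^ (m + 1)) (S (R x) - a • R x)‖ ^ 2 - ‖(B ^ (m + 1)) x‖ ^ 2 =
        (1 - ‖a‖ ^ 2) * (‖(B ^ m) (R x)‖ ^ 2 - ‖(B ^ (m + 1)) (R x)‖ ^ 2) := fun m => by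
      have h2 : ∀ y, (B ^ (m + 1)) (S y) = (B ^ m) y := fun y => by
        rw [pow_succ, mul_apply_eq_comp, B_S]
      rw [← norm_sub_smul_sq_sub]
      have hx := congrArg (B ^ (m + 1)) (hRu x)
      rw [map_sub, map_smul, h2] at hx
      rw [← hx, map_sub, map_smul, h2]
    have h3 : energy M (S (R x) - a • R x) - energy M x =
        (1 - ‖a‖ ^ 2) * (‖R x‖ ^ 2 - ‖(B ^ M) (R x)‖ ^ 2) := by
      rw [energy, energy, ← Finset.sum_sub_distrib, Finset.sum_congr rfl fun m _ => h1 m,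
        ← Finset.mul_sum, Finset.sum_range_sub']
      rfl
    have h4 : ‖R x‖ ^ 2 ≤ ‖R‖ ^ 2 * ‖x‖ ^ 2 := by
      rw [← mul_pow]; gcongr; exact R.le_opNorm x
    rw [hTx]
    have h5 : 0 ≤ ‖(B ^ M) (R x)‖ ^ 2 := by positivity
    have h6 : 0 ≤ ‖R x‖ ^ 2 := by positivity
    have h7 : 0 ≤ 1 - ‖a‖ ^ 2 := by nlinarith [norm_nonneg a]
    have h8 : 0 ≤ ‖a‖ ^ 2 := by positivity
    nlinarith [mul_nonneg h7 h5, mul_nonneg h8 h6]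
  · set T := (S - a • (1 : Hardy →L[ℂ] Hardy)) * R with hT
    refine ⟨Unit, inferInstance, fun _ => kern a, fun _ z => (1 - conj a * z)⁻¹,
      fun _ => (innerSL ℂ (mono 0)).comp (1 - T.comp (adjoint T)), fun _ z hz => ?_,
      fun _ z hz => ev_kern ha hz, fun x => ?_⟩
    · have : 1 - conj a * z ≠ 0 := one_sub_conj_mul_ne_zero ha (by simpa using hz)
      fun_prop (disch := assumption)
    · set y := x - T (adjoint T x) with hy
      -- `y` lies in the kernel of `T†`, so its coefficients form a geometric sequence
      have hTy : adjoint T y = 0 := by rw [hy, map_sub, adjoint_apply_apply hnorm, sub_self]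
      have hy1 : ∀ w, inner ℂ (S w - a • w) y = 0 := fun w => by
        have h1 := hTx (w - conj a • S w)
        rw [huR] at h1
        rw [← h1, ← ContinuousLinearMap.adjoint_inner_right, hTy, inner_zero_right]
      have hrec : ∀ n, y (n + 1) = conj a * y n := fun n => by
        have := hy1 (mono n)
        rw [S_mono, inner_sub_left, inner_smul_left, inner_mono, inner_mono] at this
        exact sub_eq_zero.1 this
      have hyn : ∀ n, y n = y 0 * conj a ^ n := fun n => by
        induction n with
        | zero => simp
        | succ n ih => rw [hrec, ih]; ring
      have hc : ((innerSL ℂ (mono 0)).comp (1 - T.comp (adjoint T))) x = y 0 := by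
        simp [inner_mono, hy]
      simp only [Finset.univ_unique, Finset.sum_singleton]
      rw [hc]
      ext n
      rw [hyn, lp.coeFn_smul, Pi.smul_apply, kern_apply ha, smul_eq_mul]

lemma exists_isModelOperator {φ : ℂ → ℂ} (h : IsFiniteBlaschkeProduct φ) :
    ∃ W ψ, IsModelOperator W ψ ∧ Set.EqOn φ ψ disc := by
  obtain ⟨n, c, a, hc, ha, hφ⟩ := h
  suffices H : ∀ s : Finset (Fin n), ∃ W, IsModelOperator W
      fun z => c * ∏ i ∈ s, blaschkeFactor (a i) z by
    obtain ⟨W, hW⟩ := H Finset.univ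
    exact ⟨W, _, hW, fun z hz => hφ z hz⟩
  intro s
  induction s using Finset.induction_on with
  | empty => exact ⟨_, by simpa using isModelOperator_const hc⟩
  | insert i s hi ih =>
    obtain ⟨W, hW⟩ := ih
    obtain ⟨W', hW'⟩ := exists_isModelOperator_blaschkeFactor (ha i)
    refine ⟨W' * W, ?_⟩
    convert! hW'.comp hW using 2 with z
    rw [Finset.prod_insert hi]
    ring

/-! ### Blaschke products fixing the origin -/

lemma norm_pow_apply {T : Hardy →L[ℂ] Hardy} (hT : ∀ x, ‖T x‖ = ‖x‖) (k : ℕ) (x : Hardy) :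
    ‖(T ^ k) x‖ = ‖x‖ := by
  induction k with
  | zero => simp
  | succ k ih => rw [pow_succ', mul_apply_eq_comp, hT, ih]

lemma inner_pow_apply {T : Hardy →L[ℂ] Hardy} (hT : ∀ x, ‖T x‖ = ‖x‖) (k : ℕ) (x y : Hardy) :
    inner ℂ ((T ^ k) x) ((T ^ k) y) = inner ℂ x y := by
  rw [← ContinuousLinearMap.adjoint_inner_right, adjoint_apply_apply (norm_pow_apply hT k)]

lemma orthonormal_pow_apply {T : Hardy →L[ℂ] Hardy} (hT : ∀ x, ‖T x‖ = ‖x‖) {p : Hardy}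
    (hp : ‖p‖ = 1) (h : ∀ m, inner ℂ p ((T ^ (m + 1)) p) = 0) :
    Orthonormal ℂ fun j => (T ^ j) p := by
  have key : ∀ i m, inner ℂ ((T ^ i) p) ((T ^ (i + (m + 1))) p) = 0 := fun i m => by
    rw [pow_add, mul_apply_eq_comp, inner_pow_apply hT, h]
  refine ⟨fun j => by rw [norm_pow_apply hT, hp], fun i j hij => ?_⟩
  rcases lt_or_gt_of_ne hij with hlt | hlt
  · obtain ⟨m, rfl⟩ := Nat.exists_eq_add_of_lt hlt
    exact key i m
  · obtain ⟨m, rfl⟩ := Nat.exists_eq_add_of_lt hlt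
    rw [← inner_conj_symm]
    exact (congrArg conj (key j m)).trans (map_zero _)

lemma exists_isometry_of_orthonormal {v : ℕ → Hardy} (hv : Orthonormal ℂ v) :
    ∃ C : Hardy →L[ℂ] Hardy, (∀ x, ‖C x‖ = ‖x‖) ∧ ∀ x, HasSum (fun k => x k • v k) (C x) :=
  ⟨hv.orthogonalFamily.linearIsometry.toContinuousLinearMap,
    fun x => hv.orthogonalFamily.linearIsometry.norm_map x,
    fun x => by simpa using hv.orthogonalFamily.hasSum_linearIsometry x⟩

lemma ev_zero (x : Hardy) : ev 0 x = x 0 := (isTaylor_ev x).apply_zero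

lemma S_B {x : Hardy} (h : x 0 = 0) : S (B x) = x := by
  ext n; cases n <;> simp [h]

lemma eq_add_S_B (x : Hardy) : x = x 0 • mono 0 + S (B x) := by
  ext n
  rw [lp.coeFn_add, Pi.add_apply, lp.coeFn_smul, Pi.smul_apply, mono_apply]
  cases n <;> simp

lemma norm_B_pow_le (m : ℕ) (x : Hardy) : ‖(B ^ m) x‖ ≤ ‖x‖ := by
  induction m with
  | zero => simp
  | succ m ih =>
    rw [pow_succ', mul_apply_eq_comp]
    exact (norm_adjoint_apply_le norm_S _).trans ih

lemma energy_le_mul (M : ℕ) (x : Hardy) : energy M x ≤ M * ‖x‖ ^ 2 := by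
  have := Finset.sum_le_card_nsmul (Finset.range M) (fun m => ‖(B ^ (m + 1)) x‖ ^ 2) (‖x‖ ^ 2)
    fun m _ => by gcongr; exact norm_B_pow_le _ x
  simpa [energy] using this

lemma energy_smul_mono_zero_add (M : ℕ) (c : ℂ) (x : Hardy) :
    energy M (c • mono 0 + x) = energy M x := by
  have : ∀ m, (B ^ (m + 1)) (mono 0) = 0 := fun m => by
    ext n; rw [B_pow_apply, mono_apply]; simp
  simp only [energy, map_add, map_smul, this, smul_zero, zero_add]

lemma energy_succ' (M : ℕ) (x : Hardy) : energy (M + 1) x = energy M (B x) + ‖B x‖ ^ 2 := by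
  rw [energy, Finset.sum_range_succ']
  simp [energy, pow_succ]

lemma tendsto_norm_B_pow {x : Hardy} {C : ℝ} (h : ∀ M, energy M x ≤ C) :
    Tendsto (fun N => ‖(B ^ N) x‖ ^ 2) atTop (𝓝 0) := by
  rw [← tendsto_add_atTop_iff_nat 1]
  exact (summable_of_sum_range_le (fun _ => by positivity) h).tendsto_atTop_zero

lemma IsModelOperator.apply_zero {V : Hardy →L[ℂ] Hardy} {g : ℂ → ℂ} (h : IsModelOperator V g)
    (h0 : g 0 = 0) (x : Hardy) : V x 0 = 0 := by
  rw [← ev_zero, h.ev_apply 0 zero_mem_disc, h0, zero_mul]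

lemma IsModelOperator.ev_pow_apply {V : Hardy →L[ℂ] Hardy} {g : ℂ → ℂ} (h : IsModelOperator V g)
    {z : ℂ} (hz : z ∈ disc) (k : ℕ) (x : Hardy) : ev z ((V ^ k) x) = g z ^ k * ev z x := by
  induction k with
  | zero => simp
  | succ k ih => rw [pow_succ', mul_apply_eq_comp, h.ev_apply z hz, ih]; ring

/-- Composition with a finite Blaschke product fixing the origin preserves the Dirichlet space.
The composition operator is an isometry `C` of the Hardy space with
`C x = x 0 + V (C (B x))`, and each application of `V` costs at most a multiple of a Hardy norm;
the costs add up to the Dirichlet integral of `f`. -/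
lemma IsModelOperator.comp_mem_dirichlet {V : Hardy →L[ℂ] Hardy} {g : ℂ → ℂ}
    (h : IsModelOperator V g) (h0 : g 0 = 0) (hm : Set.MapsTo g disc disc) {f : ℂ → ℂ}
    (hf : f ∈ dirichlet) : (fun z => f (g z)) ∈ dirichlet := by
  obtain ⟨x, hx⟩ := exists_hardy_of_mem_dirichlet hf
  obtain ⟨E, hE⟩ := (hardy_mem_dirichlet_iff x).1 (dirichlet_congr hx hf)
  have hV := h.norm_map
  obtain ⟨C, hC, hsum⟩ := exists_isometry_of_orthonormal
    (orthonormal_pow_apply hV (p := mono 0) (by simp [mono, lp.norm_single]) fun m => by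
      rw [pow_succ', mul_apply_eq_comp, inner_mono, h.apply_zero h0])
  have hev : ∀ z ∈ disc, ∀ x, ev z (C x) = ev (g z) x := fun z hz x => by
    have h1 := (hsum x).mapL (ev z)
    refine h1.unique ?_
    convert! isTaylor_ev x (g z) (hm hz) using 2 with k
    rw [map_smul, h.ev_pow_apply hz, ev_mono_zero hz, mul_one, smul_eq_mul]
  -- both sides have the same values, since `f (w) = f (0) + w (B f) (w)`
  have hrec : ∀ x, C x = x 0 • mono 0 + V (C (B x)) := fun x => by
    refine Hardy.ext_ev fun z hz => ?_
    rw [hev z hz, map_add, map_smul, ev_mono_zero hz, h.ev_apply z hz, hev z hz]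
    conv_lhs => rw [eq_add_S_B x]
    rw [map_add, map_smul, ev_S (hm hz), ev_mono_zero (hm hz)]
  obtain ⟨K, hK0, hK⟩ := h.energy_le
  have hstep : ∀ M x, energy M (C x) ≤ energy M (C (B x)) + K * ‖B x‖ ^ 2 := fun M x => by
    rw [hrec, energy_smul_mono_zero_add, ← hC (B x)]
    exact hK M _
  have hiter : ∀ M N x, energy M (C x) ≤ energy M (C ((B ^ N) x)) + K * energy N x := by
    intro M N
    induction N with
    | zero => intro x; simp [energy]
    | succ N ih =>
      intro x
      have h1 := hstep M x
      have h2 := ih (B x)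
      rw [energy_succ', pow_succ, mul_apply_eq_comp]
      linarith
  refine dirichlet_congr (f := fun z => ev z (C x)) (fun z hz => ?_)
    ((hardy_mem_dirichlet_iff _).2 ⟨K * E, fun M => ?_⟩)
  · simp only [hev z hz, hx _ (hm hz)]
  · have h1 : ∀ N, energy M (C x) ≤ M * ‖(B ^ N) x‖ ^ 2 + K * E := fun N => by
      have h2 := hiter M N x
      have h3 := energy_le_mul M (C ((B ^ N) x))
      rw [hC] at h3
      have h4 := mul_le_mul_of_nonneg_left (hE N) hK0
      linarith
    have h2 : Tendsto (fun N => M * ‖(B ^ N) x‖ ^ 2 + K * E) atTop (𝓝 (M * 0 + K * E)) :=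
      ((tendsto_norm_B_pow hE).const_mul _).add_const _
    have := ge_of_tendsto' h2 h1
    simpa using this

/-- If the multiplier vanishes at the origin, then its adjoint powers are dominated by those of the
backward shift. -/
lemma IsModelOperator.norm_adjoint_pow_le {V : Hardy →L[ℂ] Hardy} {g : ℂ → ℂ}
    (h : IsModelOperator V g) (h0 : g 0 = 0) (k : ℕ) (x : Hardy) :
    ‖((adjoint V) ^ k) x‖ ≤ ‖(B ^ k) x‖ := by
  have hSW : S * (B * V) = V := by
    ext x : 1
    rw [mul_apply_eq_comp, mul_apply_eq_comp, S_B (h.apply_zero h0 x)]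
  have hBS : B * S = 1 := by ext x : 1; rw [mul_apply_eq_comp, B_S]; rfl
  have hcomm : Commute S (B * V) := by
    rw [commute_iff_eq, hSW, mul_assoc, h.commute.eq, ← mul_assoc, hBS, one_mul]
  have hW : ∀ x, ‖(B * V) x‖ = ‖x‖ := fun x => by
    rw [← h.norm_map x]
    conv_rhs => rw [← hSW, mul_apply_eq_comp, norm_S]
  have hpow : (adjoint V) ^ k = adjoint ((B * V) ^ k) * B ^ k := by
    have h1 : V ^ k = S ^ k * (B * V) ^ k := by
      rw [← hcomm.mul_pow, hSW]
    have h2 := congrArg star h1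
    rwa [star_mul, star_pow, star_pow S, ContinuousLinearMap.star_eq_adjoint,
      ContinuousLinearMap.star_eq_adjoint, ContinuousLinearMap.star_eq_adjoint] at h2
  rw [hpow, mul_apply_eq_comp]
  exact norm_adjoint_apply_le (norm_pow_apply hW k) _

lemma sum_range_mul_sub (s : ℕ → ℝ) (N : ℕ) :
    ∑ k ∈ Finset.range N, (k : ℝ) * (s k - s (k + 1)) + N * s N =
      ∑ k ∈ Finset.range N, s (k + 1) := by
  induction N with
  | zero => simp
  | succ N ih => rw [Finset.sum_range_succ, Finset.sum_range_succ, ← ih]; push_cast; ring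

lemma dirichlet_sum {ι : Type} (s : Finset ι) {f : ι → ℂ → ℂ} (hf : ∀ i, f i ∈ dirichlet) :
    (fun z => ∑ i ∈ s, f i z) ∈ dirichlet := by
  classical
  induction s using Finset.induction_on with
  | empty => exact ⟨by simp, by simp [normSq]⟩
  | insert i s hi ih =>
    simp only [Finset.sum_insert hi]
    exact dirichlet_add (hf i) ih

/-- Every function in the Dirichlet space is a combination `∑ hᵢ · (Gᵢ ∘ g)`, with finitely many
fixed `hᵢ` analytic across the circle and `Gᵢ` in the Dirichlet space. The Taylor coefficients of
the `Gᵢ` are the coordinates of the wandering parts `y k` of `x = ∑ V ^ k (y k)`. -/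
lemma IsModelOperator.exists_decomposition {V : Hardy →L[ℂ] Hardy} {g : ℂ → ℂ}
    (h : IsModelOperator V g) (h0 : g 0 = 0) (hm : Set.MapsTo g disc disc) {f : ℂ → ℂ}
    (hf : f ∈ dirichlet) :
    ∃ (ι : Type) (_ : Fintype ι) (H G : ι → ℂ → ℂ), (∀ i, H i ∈ multipliers) ∧
      (∀ i, G i ∈ dirichlet) ∧ ∀ z ∈ disc, f z = ∑ i, H i z * G i (g z) := by
  obtain ⟨x, hx⟩ := exists_hardy_of_mem_dirichlet hf
  obtain ⟨E, hE⟩ := (hardy_mem_dirichlet_iff x).1 (dirichlet_congr hx hf)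
  obtain ⟨ι, _, e, H, c, hH, hev, hd⟩ := h.defect
  have hV := h.norm_map
  set X : ℕ → Hardy := fun k => ((adjoint V) ^ k) x with hX
  have hXs : ∀ k, X (k + 1) = adjoint V (X k) := fun k => by
    simp only [hX, pow_succ', mul_apply_eq_comp]
  set y : ℕ → Hardy := fun k => X k - V (X (k + 1)) with hy
  -- `y k` lies in the kernel of `V†`, where `1 - V V†` is the identity; thus the coordinates of
  -- `y k` are bounded by its norm
  have hysum : ∀ k, y k = ∑ i, c i (y k) • e i := fun k => by
    rw [← hd (y k)]
    have : adjoint V (y k) = 0 := by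
      rw [hy]; simp only [map_sub, adjoint_apply_apply hV, hXs, sub_self]
    rw [this, map_zero, sub_zero]
  have hynorm : ∀ k, ‖y k‖ ^ 2 = ‖X k‖ ^ 2 - ‖X (k + 1)‖ ^ 2 := fun k => by
    rw [norm_sq_eq_adjoint hV (X k), ← hXs]; ring
  -- the sum telescopes by Abel summation
  have hys : Summable fun k : ℕ => (k : ℝ) * ‖y k‖ ^ 2 := by
    refine summable_of_sum_range_le (c := E) (fun k => by positivity) fun N => ?_
    simp_rw [hynorm]
    have h1 := sum_range_mul_sub (fun k => ‖X k‖ ^ 2) N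
    have h2 : ∑ k ∈ Finset.range N, ‖X (k + 1)‖ ^ 2 ≤ energy N x :=
      Finset.sum_le_sum fun k _ => by
        gcongr
        exact h.norm_adjoint_pow_le h0 (k + 1) x
    have h3 : 0 ≤ (N : ℝ) * ‖X N‖ ^ 2 := by positivity
    linarith [hE N]
  have hcs : ∀ i, Summable fun k : ℕ => (k : ℝ) * ‖c i (y k)‖ ^ 2 := fun i => by
    refine (hys.mul_left (‖c i‖ ^ 2)).of_nonneg_of_le (fun k => by positivity) fun k => ?_
    have : ‖c i (y k)‖ ^ 2 ≤ ‖c i‖ ^ 2 * ‖y k‖ ^ 2 := by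
      rw [← mul_pow]; gcongr; exact (c i).le_opNorm _
    calc (k : ℝ) * ‖c i (y k)‖ ^ 2 ≤ k * (‖c i‖ ^ 2 * ‖y k‖ ^ 2) := by gcongr
      _ = _ := by ring
  choose b hb using fun i => exists_hardy (summable_sq_of_summable_mul_sq (hcs i))
  refine ⟨ι, inferInstance, H, fun i z => ev z (b i), fun i => analytic_mem_multipliers (hH i),
    fun i => (isTaylor_ev (b i)).mem_dirichlet_iff.2 (by simpa only [hb] using hcs i),
    fun z hz => ?_⟩
  have hexp : ∀ N, x = ∑ k ∈ Finset.range N, (V ^ k) (y k) + (V ^ N) (X N) := fun N => by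
    induction N with
    | zero => simp [hX]
    | succ N ih =>
      rw [Finset.sum_range_succ, pow_succ, mul_apply_eq_comp, add_assoc, ← map_add, hy]
      simp only [sub_add_cancel]
      exact ih
  have hpart : ∀ N, f z - g z ^ N * ev z (X N) =
      ∑ i, H i z * ∑ k ∈ Finset.range N, b i k * g z ^ k := fun N => by
    rw [hx z hz]
    conv_lhs => rw [hexp N]
    rw [map_add, h.ev_pow_apply hz, add_sub_cancel_right, map_sum]
    simp_rw [Finset.mul_sum]
    rw [Finset.sum_comm]
    refine Finset.sum_congr rfl fun k _ => ?_
    rw [h.ev_pow_apply hz, hysum k, map_sum, Finset.mul_sum]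
    refine Finset.sum_congr rfl fun i _ => ?_
    rw [map_smul, hev i z hz, hb, smul_eq_mul]
    ring
  have hlim1 : Tendsto (fun N => f z - g z ^ N * ev z (X N)) atTop (𝓝 (f z)) := by
    have : Tendsto (fun N => g z ^ N * ev z (X N)) atTop (𝓝 0) := by
      refine squeeze_zero_norm (a := fun N => ‖g z‖ ^ N * (‖ev z‖ * ‖x‖)) (fun N => ?_) ?_
      · rw [norm_mul, norm_pow]
        gcongr
        refine (ev z).le_opNorm_of_le ?_
        exact (h.norm_adjoint_pow_le h0 N x).trans (norm_B_pow_le N x)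
      · simpa using (tendsto_pow_atTop_nhds_zero_of_lt_one (norm_nonneg _)
          (mem_disc.1 (hm hz))).mul_const (‖ev z‖ * ‖x‖)
    simpa using this.const_sub (f z)
  refine tendsto_nhds_unique hlim1 ?_
  simp_rw [hpart]
  exact tendsto_finsetSum _ fun i _ =>
    ((isTaylor_ev (b i) (g z) (hm hz)).tendsto_sum_nat).const_mul _

lemma mem_multipliers_of_comp {V : Hardy →L[ℂ] Hardy} {g : ℂ → ℂ}
    (h : IsModelOperator V g) (h0 : g 0 = 0) (hm : Set.MapsTo g disc disc) {u : ℂ → ℂ}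
    (hu : ∀ f ∈ dirichlet, (fun z => u z * f (g z)) ∈ dirichlet) : u ∈ multipliers := by
  intro f hf
  obtain ⟨ι, _, H, G, hH, hG, hfG⟩ := h.exists_decomposition h0 hm hf
  refine dirichlet_congr (f := fun z => ∑ i, H i z * (u z * G i (g z))) (fun z hz => ?_)
    (dirichlet_sum _ fun i => hH i _ (hu _ (hG i)))
  simp only [hfG z hz, Finset.mul_sum]
  exact Finset.sum_congr rfl fun i _ => by ring

/-! ### The closed graph theorem and multipliers of finite Blaschke products -/

/-- The weight `√(max n 1)` for which `x ↦ ∑ (x n / weight n) z ^ n` identifies square-summable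
sequences isometrically with the Dirichlet space. -/
noncomputable def weight (n : ℕ) : ℝ := √(max (n : ℝ) 1)

lemma weight_sq (n : ℕ) : weight n ^ 2 = max (n : ℝ) 1 := Real.sq_sqrt (by positivity)

lemma one_le_weight (n : ℕ) : 1 ≤ weight n := Real.one_le_sqrt.2 (le_max_right _ _)

lemma weight_ne_zero (n : ℕ) : (weight n : ℂ) ≠ 0 := by
  exact_mod_cast (zero_lt_one.trans_le (one_le_weight n)).ne'

/-- Division of a sequence by the Dirichlet weights. -/
noncomputable def divWeight (a : ℕ → ℂ) : ℕ → ℂ := fun n => a n / weight n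

lemma norm_divWeight_le (x : Hardy) (n : ℕ) : ‖divWeight x n‖ ^ 2 ≤ ‖x n‖ ^ 2 := by
  have h := one_le_weight n
  rw [divWeight, norm_div, Complex.norm_real, Real.norm_of_nonneg (zero_le_one.trans h)]
  gcongr
  exact div_le_self (norm_nonneg _) h

lemma memℓp_divWeight (x : Hardy) : Memℓp (divWeight x) 2 :=
  memℓp_two (x.hasSum_sq.summable.of_nonneg_of_le (fun n => by positivity)
    (norm_divWeight_le x))

/-- Division by the Dirichlet weights as a linear map; its values are the coefficient sequences of
the functions in the Dirichlet space. -/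
noncomputable def unweightₗ : Hardy →ₗ[ℂ] Hardy where
  toFun x := ⟨divWeight x, memℓp_divWeight x⟩
  map_add' x y := by
    ext n
    change divWeight (x + y : Hardy) n = divWeight x n + divWeight y n
    simp [divWeight, add_div]
  map_smul' c x := by
    ext n
    change divWeight (c • x : Hardy) n = c * divWeight x n
    simp [divWeight, mul_div_assoc]

lemma unweightₗ_apply (x : Hardy) (n : ℕ) : unweightₗ x n = divWeight x n := rfl

lemma norm_unweightₗ_le (x : Hardy) : ‖unweightₗ x‖ ≤ 1 * ‖x‖ := by
  rw [one_mul]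
  refine (sq_le_sq₀ (norm_nonneg _) (norm_nonneg _)).1 ?_
  have h := (unweightₗ x).hasSum_sq
  simp only [unweightₗ_apply] at h
  exact hasSum_le (norm_divWeight_le x) h x.hasSum_sq

/-- Division by the Dirichlet weights as an operator. -/
noncomputable def unweight : Hardy →L[ℂ] Hardy := unweightₗ.mkContinuous 1 norm_unweightₗ_le

lemma unweight_apply (x : Hardy) (n : ℕ) : unweight x n = x n / weight n := rfl

lemma unweight_injective : Function.Injective unweight := fun x y h => by
  ext n
  have := congrArg (fun w : Hardy => w n) h
  simp only [unweight_apply] at this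
  exact (div_left_inj' (weight_ne_zero n)).1 this

lemma max_mul_norm_div_sq (w : ℂ) (n : ℕ) :
    max (n : ℝ) 1 * ‖w / (weight n : ℂ)‖ ^ 2 = ‖w‖ ^ 2 := by
  have h := zero_lt_one.trans_le (one_le_weight n)
  rw [norm_div, Complex.norm_real, Real.norm_of_nonneg h.le, div_pow, ← weight_sq]
  field_simp

lemma normSq_ev_unweight (x : Hardy) :
    normSq (fun z => ev z (unweight x)) = ENNReal.ofReal (‖x‖ ^ 2) := by
  rw [(isTaylor_ev _).normSq_eq, ← x.hasSum_sq.tsum_eq,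
    ENNReal.ofReal_tsum_of_nonneg (fun _ => by positivity) x.hasSum_sq.summable]
  simp only [unweight_apply, max_mul_norm_div_sq]

lemma ev_unweight_mem (x : Hardy) : (fun z => ev z (unweight x)) ∈ dirichlet :=
  ⟨(isTaylor_ev _).differentiableOn, by rw [normSq_ev_unweight]; exact ENNReal.ofReal_lt_top⟩

lemma exists_unweight {f : ℂ → ℂ} (hf : f ∈ dirichlet) :
    ∃ x : Hardy, ∀ z ∈ disc, f z = ev z (unweight x) := by
  obtain ⟨a, ha, hs⟩ := dirichlet_exists_isTaylor hf
  have hs' : Summable fun n => ‖weight n * a n‖ ^ 2 := by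
    refine (summable_max_iff.2 hs).congr fun n => ?_
    rw [norm_mul, mul_pow, Complex.norm_real, Real.norm_eq_abs, sq_abs, weight_sq]
  obtain ⟨x, hx⟩ := exists_hardy hs'
  refine ⟨x, fun z hz => (ha z hz).unique ?_⟩
  convert! isTaylor_ev (unweight x) z hz using 2 with n
  rw [unweight_apply, hx, mul_div_cancel_left₀ _ (weight_ne_zero n)]

/-- The closed graph theorem for weighted composition operators: if one maps the Dirichlet space
into itself, then it is bounded there. -/
lemma boundedOnDirichlet_of_mapsTo {u φ : ℂ → ℂ} (hφ : Set.MapsTo φ disc disc)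
    (h : ∀ f ∈ dirichlet, weightedComp u φ f ∈ dirichlet) :
    BoundedOnDirichlet (weightedComp u φ) := by
  choose A hA using fun x : Hardy => exists_unweight (h _ (ev_unweight_mem x))
  have huniq : ∀ x y : Hardy, (∀ z ∈ disc, ev z (unweight x) = ev z (unweight y)) → x = y :=
    fun x y hxy => unweight_injective (Hardy.ext_ev hxy)
  let L : Hardy →ₗ[ℂ] Hardy :=
    { toFun := A
      map_add' := fun x y => huniq _ _ fun z hz => by
        simp only [map_add, ← hA _ z hz, weightedComp]; ring
      map_smul' := fun c x => huniq _ _ fun z hz => by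
        simp only [map_smul, RingHom.id_apply, ← hA _ z hz, weightedComp, smul_eq_mul]; ring }
  -- the graph is closed because point evaluations are continuous
  have hcont : Continuous L := by
    refine L.continuous_of_seq_closed_graph fun s x y hs hLs => huniq _ _ fun z hz => ?_
    have h1 : Tendsto (fun n => ev z (unweight (L (s n)))) atTop (𝓝 (ev z (unweight y))) :=
      (((ev z).comp unweight).continuous.tendsto y).comp hLs
    have h2 : Tendsto (fun n => u z * ev (φ z) (unweight (s n))) atTop
        (𝓝 (u z * ev (φ z) (unweight x))) :=
      ((((ev (φ z)).comp unweight).continuous.tendsto x).comp hs).const_mul _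
    have h3 : ∀ n, ev z (unweight (L (s n))) = u z * ev (φ z) (unweight (s n)) := fun n =>
      (hA (s n) z hz).symm
    simp_rw [h3] at h1
    rw [tendsto_nhds_unique h1 h2]
    exact hA x z hz
  let T : Hardy →L[ℂ] Hardy := ⟨L, hcont⟩
  refine ⟨‖T‖₊, fun f hf => ⟨h f hf, ?_⟩⟩
  obtain ⟨x, hx⟩ := exists_unweight hf
  have h1 : normSq (weightedComp u φ f) = ENNReal.ofReal (‖T x‖ ^ 2) := by
    rw [← normSq_ev_unweight]
    refine normSq_congr fun z hz => ?_
    change _ = ev z (unweight (A x))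
    rw [← hA x z hz, weightedComp, weightedComp, hx _ (hφ hz)]
  rw [h1, normSq_congr hx, normSq_ev_unweight]
  have h2 : (‖T‖₊ : ℝ≥0∞) ^ 2 = ENNReal.ofReal (‖T‖ ^ 2) := by
    rw [ENNReal.ofReal_pow (norm_nonneg _), ofReal_norm, enorm_eq_nnnorm]
  rw [h2, ← ENNReal.ofReal_mul (by positivity), ← mul_pow]
  gcongr
  exact T.le_opNorm x

lemma const_mem_dirichlet (c : ℂ) : (fun _ => c) ∈ dirichlet :=
  ⟨differentiableOn_const c, by simp [normSq]⟩

lemma id_mem_dirichlet : (fun z => z) ∈ dirichlet := by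
  simpa using analytic_mem_multipliers analyticOnNhd_id _ (const_mem_dirichlet 1)

lemma mem_dirichlet_of_mem_multipliers {u : ℂ → ℂ} (hu : u ∈ multipliers) : u ∈ dirichlet := by
  simpa using hu _ (const_mem_dirichlet 1)

/-- A finite Blaschke product followed by the disc automorphism that moves its value at the origin
to the origin. -/
lemma IsFiniteBlaschkeProduct.exists_isModelOperator_normalized {φ : ℂ → ℂ}
    (h : IsFiniteBlaschkeProduct φ) (hd : DifferentiableOn ℂ φ disc)
    (hm : Set.MapsTo φ disc disc) :
    ∃ V g, IsModelOperator V g ∧ g 0 = 0 ∧ Set.MapsTo g disc disc ∧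
      ∀ z ∈ disc, g z = blaschkeFactor (φ 0) (φ z) := by
  have ha := hm zero_mem_disc
  have hu : UnimodularAtBoundary fun z => blaschkeFactor (φ 0) (φ z) :=
    (unimodularAtBoundary_blaschkeFactor ha).comp (h.unimodularAtBoundary.tendsto_boundary hm)
  obtain ⟨V, g, hV, hg⟩ := exists_isModelOperator (hu.isFiniteBlaschkeProduct
    ((blaschkeFactor_differentiableOn ha).comp hd hm))
  refine ⟨V, g, hV, ?_, fun z hz => ?_, fun z hz => (hg hz).symm⟩
  · rw [← hg zero_mem_disc]; simp [blaschkeFactor]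
  · rw [← hg hz]; exact blaschkeFactor_mem_disc ha (hm hz)

/-- Since `f ∘ b ∈ 𝓓` for `f ∈ 𝓓` and disc automorphisms `b`, the Blaschke product `φ` may be
replaced by one fixing the origin. -/
lemma multiplierSpace_eq_multipliers {φ : ℂ → ℂ}
    (h : IsFiniteBlaschkeProduct φ) (hd : DifferentiableOn ℂ φ disc)
    (hm : Set.MapsTo φ disc disc) : multiplierSpace φ = multipliers := by
  have ha := hm zero_mem_disc
  obtain ⟨V, g, hV, hg0, hgm, hg⟩ := h.exists_isModelOperator_normalized hd hm
  ext u
  constructor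
  · rintro ⟨-, C, hC⟩
    refine mem_multipliers_of_comp hV hg0 hgm fun f hf => ?_
    refine dirichlet_congr (fun z hz => ?_) (hC _ (dirichlet_comp_blaschkeFactor hf ha)).1
    rw [weightedComp, hg z hz]
  · intro hu
    refine ⟨mem_dirichlet_of_mem_multipliers hu,
      boundedOnDirichlet_of_mapsTo hm fun f hf => hu _ ?_⟩
    refine dirichlet_congr (fun z hz => ?_) (hV.comp_mem_dirichlet hg0 hgm
      (dirichlet_comp_blaschkeFactor hf (neg_mem_disc ha)))
    rw [hg z hz, blaschkeFactor_neg_blaschkeFactor ha (hm hz)]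

/-! ### Inner functions in the Dirichlet space -/

lemma summable_norm_mul_norm_add (p : Hardy) (m : ℕ) :
    Summable fun n => ‖p n‖ * ‖p (n + m)‖ := by
  refine (p.hasSum_sq.summable.add (norm_B_pow_sq m p).summable).of_nonneg_of_le
    (fun n => by positivity) fun n => ?_
  nlinarith [sq_nonneg (‖p n‖ - ‖p (n + m)‖), sq_nonneg ‖p n‖, sq_nonneg ‖p (n + m)‖]

/-- The autocorrelations of the Taylor coefficients of an inner function are those of a
constant. -/
lemma IsInner.tsum_mul_conj {φ : ℂ → ℂ} (hφ : IsInner φ) {p : Hardy}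
    (hp : ∀ z ∈ disc, φ z = ev z p) (m : ℕ) :
    ∑' n, p n * conj (p (n + m)) = if m = 0 then 1 else 0 := by
  have hT : IsTaylor p φ := (isTaylor_ev p).congr fun z hz => (hp z hz).symm
  have hIoo : Set.Ioo (0 : ℝ) 1 ∈ 𝓝[<] (1 : ℝ) := Ioo_mem_nhdsLT one_pos
  have h1 : Tendsto (fun r : ℝ => ∫ θ in (-Real.pi)..Real.pi,
      φ (r * exp (θ * I)) * (exp (m * (θ * I)) * conj (φ (r * exp (θ * I))))) (𝓝[<] 1)
      (𝓝 (∫ θ in (-Real.pi)..Real.pi, exp (((m : ℤ) : ℂ) * (θ * I)))) := by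
    refine intervalIntegral.tendsto_integral_filter_of_dominated_convergence (fun _ => 1) ?_ ?_
      (by simp) ?_
    · filter_upwards [hIoo] with r hr
      have hc := hT.continuous_circle hr.1.le hr.2
      exact (hc.mul ((by fun_prop : Continuous fun θ : ℝ => exp (m * (θ * I))).mul
        (Complex.continuous_conj.comp hc))).aestronglyMeasurable
    · filter_upwards [hIoo] with r hr
      refine ae_of_all _ fun θ _ => ?_
      have h2 := hφ.norm_le_one _ (circle_mem_disc hr.1.le hr.2 θ)
      have h3 : ‖exp (m * (θ * I))‖ = 1 := by
        rw [← Complex.norm_exp_ofReal_mul_I (m * θ)]; push_cast; ring_nf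
      rw [norm_mul, norm_mul, h3, RCLike.norm_conj, one_mul]
      exact mul_le_one₀ h2 (norm_nonneg _) h2
    · filter_upwards [hφ.radial_limit] with θ hθ _
      obtain ⟨w, hw, hlim⟩ := hθ
      have h2 := hlim.mul (((Complex.continuous_conj.tendsto w).comp hlim).const_mul
        (exp (m * (θ * I))))
      convert! h2 using 2
      rw [Int.cast_natCast, mul_left_comm w, Complex.mul_conj, Complex.normSq_eq_norm_sq, hw]
      simp
  have h2 : Tendsto (fun r : ℝ => ∑' n,
      2 * Real.pi * (p n * conj (p (n + m)) * (r : ℂ) ^ (2 * n + m))) (𝓝[<] 1)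
      (𝓝 (∑' n, 2 * Real.pi * (p n * conj (p (n + m))))) := by
    refine tendsto_tsum_of_dominated_convergence
      (bound := fun n => 2 * Real.pi * (‖p n‖ * ‖p (n + m)‖))
      ((summable_norm_mul_norm_add p m).mul_left _) (fun n => ?_) ?_
    · have : Tendsto (fun r : ℝ => 2 * Real.pi * (p n * conj (p (n + m)) * (r : ℂ) ^ (2 * n + m)))
          (𝓝 1) (𝓝 (2 * Real.pi * (p n * conj (p (n + m)) * ((1 : ℝ) : ℂ) ^ (2 * n + m)))) :=
        (by fun_prop : Continuous fun r : ℝ =>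
          (2 * Real.pi * (p n * conj (p (n + m)) * (r : ℂ) ^ (2 * n + m)) : ℂ)).tendsto 1
      simpa using this.mono_left nhdsWithin_le_nhds
    · filter_upwards [hIoo] with r hr n
      have h3 : ‖(r : ℂ)‖ ^ (2 * n + m) ≤ 1 := by
        rw [Complex.norm_real, Real.norm_of_nonneg hr.1.le]
        exact pow_le_one₀ hr.1.le hr.2.le
      have hpi := Real.pi_pos
      simp only [norm_mul, norm_pow, RCLike.norm_conj, Complex.norm_real,
        Real.norm_of_nonneg hpi.le]
      rw [← mul_assoc, Complex.norm_ofNat, ← Complex.norm_real r]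
      exact mul_le_of_le_one_right (by positivity) h3 |>.trans (by rw [mul_assoc])
  have h3 : ∀ᶠ r : ℝ in 𝓝[<] 1, ∫ θ in (-Real.pi)..Real.pi,
      φ (r * exp (θ * I)) * (exp (m * (θ * I)) * conj (φ (r * exp (θ * I)))) =
      ∑' n, 2 * Real.pi * (p n * conj (p (n + m)) * (r : ℂ) ^ (2 * n + m)) := by
    filter_upwards [hIoo] with r hr
    exact (hT.circle_correlation hr.1.le hr.2 m).tsum_eq.symm
  -- the integral and the series agree for `r < 1`, hence so do their limits at `r = 1`
  have h4 := tendsto_nhds_unique (h1.congr' h3) h2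
  rw [integral_exp_int, tsum_mul_left] at h4
  have hpi : (2 * Real.pi : ℂ) ≠ 0 := by
    have := Real.pi_ne_zero; simp [this]
  refine mul_left_cancel₀ hpi ?_
  rw [← h4]
  split_ifs with h5 h6 <;> simp_all

lemma S_pow_apply (j : ℕ) (x : Hardy) (n : ℕ) :
    (S ^ j) x n = if j ≤ n then x (n - j) else 0 := by
  induction j generalizing n with
  | zero => simp
  | succ j ih =>
    rw [pow_succ', mul_apply_eq_comp]
    cases n with
    | zero => simp
    | succ n =>
      rw [S_apply_succ, ih]
      simp only [Nat.add_le_add_iff_right, Nat.add_sub_add_right]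

lemma IsInner.inner_S_pow {φ : ℂ → ℂ} (hφ : IsInner φ) {p : Hardy}
    (hp : ∀ z ∈ disc, φ z = ev z p) (m : ℕ) :
    inner ℂ p ((S ^ m) p) = if m = 0 then 1 else 0 := by
  rw [← hφ.tsum_mul_conj hp m, ← ContinuousLinearMap.adjoint_inner_left,
    ← ContinuousLinearMap.star_eq_adjoint, star_pow, ContinuousLinearMap.star_eq_adjoint,
    lp.inner_eq_tsum]
  change ∑' n, inner ℂ ((B ^ m) p n) (p n) = _
  simp only [B_pow_apply, RCLike.inner_apply]

lemma hasSum_mono (x : Hardy) : HasSum (fun n => x n • mono n) x := by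
  have := lp.hasSum_single (p := 2) (by norm_num) x
  convert! this using 2 with n
  rw [mono, ← lp.single_smul, smul_eq_mul, mul_one]

/-- Multiplication by an inner function as an isometry of the Hardy space. -/
lemma IsInner.exists_isometry {φ : ℂ → ℂ} (hφ : IsInner φ) {p : Hardy}
    (hp : ∀ z ∈ disc, φ z = ev z p) :
    ∃ V : Hardy →L[ℂ] Hardy, (∀ x, ‖V x‖ = ‖x‖) ∧ (∀ j, V (mono j) = (S ^ j) p) ∧
      ∀ z ∈ disc, ∀ x, ev z (V x) = φ z * ev z x := by
  have hp1 : ‖p‖ = 1 := by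
    have h := hφ.inner_S_pow hp 0
    rw [if_pos rfl, pow_zero, one_apply_eq_self] at h
    have h2 := inner_self_eq_norm_sq (𝕜 := ℂ) p
    rw [h, RCLike.one_re] at h2
    nlinarith [norm_nonneg p]
  obtain ⟨V, hV, hsum⟩ := exists_isometry_of_orthonormal
    (orthonormal_pow_apply norm_S hp1 fun m => by rw [hφ.inner_S_pow hp]; simp)
  refine ⟨V, hV, fun j => ?_, fun z hz x => ?_⟩
  · refine (hsum (mono j)).unique ?_
    convert hasSum_ite_eq j ((S ^ j) p) using 2 with k
    rw [mono_apply]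
    split_ifs with h
    · rw [h, one_smul]
    · rw [zero_smul]
  · have hS : ∀ k, ev z ((S ^ k) p) = z ^ k * φ z := fun k => by
      induction k with
      | zero => simp [hp z hz]
      | succ k ih => rw [pow_succ', mul_apply_eq_comp, ev_S hz, ih]; ring
    refine ((hsum x).mapL (ev z)).unique ?_
    convert! (isTaylor_ev x z hz).mul_left (φ z) using 2 with k
    rw [map_smul, hS, smul_eq_mul]
    ring

/-- An operator with square-summable columns maps the normalized reproducing kernels to small
vectors: the first `N` columns contribute little near the circle, the others little everywhere. -/
lemma mul_norm_apply_kern_sq_le {Q : Hardy →L[ℂ] Hardy} (hcol1 : ∀ n, ‖Q (mono n)‖ ≤ 1) {N : ℕ}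
    {δ : ℝ} (hδ : ∀ M, ∑ n ∈ Finset.range M, ‖Q (mono (n + N))‖ ^ 2 ≤ δ) {z : ℂ} (hz : z ∈ disc) :
    (1 - ‖z‖ ^ 2) * ‖Q (kern z)‖ ^ 2 ≤ 2 * N ^ 2 * (1 - ‖z‖ ^ 2) + 2 * δ := by
  have hz1 := mem_disc.1 hz
  have hs : 0 < 1 - ‖z‖ ^ 2 := by nlinarith [norm_nonneg z]
  have hk : Tendsto (fun M => ∑ n ∈ Finset.range (M + N), conj z ^ n • Q (mono n)) atTop
      (𝓝 (Q (kern z))) := by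
    have := ((hasSum_mono (kern z)).mapL Q).tendsto_sum_nat
    simp only [map_smul, kern_apply hz] at this
    exact this.comp (tendsto_add_atTop_nat N)
  have hfin : ∀ M, ‖∑ n ∈ Finset.range (M + N), conj z ^ n • Q (mono n)‖ ^ 2 ≤
      2 * N ^ 2 + 2 * ((1 - ‖z‖ ^ 2)⁻¹ * δ) := fun M => by
    have hA : ‖∑ n ∈ Finset.range N, conj z ^ n • Q (mono n)‖ ≤ N := by
      refine (norm_sum_le_of_le (n := fun _ => 1) _ fun n _ => ?_).trans (by simp)
      rw [norm_smul, norm_pow, RCLike.norm_conj]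
      exact mul_le_one₀ (pow_le_one₀ (norm_nonneg _) hz1.le) (norm_nonneg _) (hcol1 n)
    have hB : ‖∑ n ∈ Finset.range M, conj z ^ (n + N) • Q (mono (n + N))‖ ^ 2 ≤
        (1 - ‖z‖ ^ 2)⁻¹ * δ := by
      have h1 : ‖∑ n ∈ Finset.range M, conj z ^ (n + N) • Q (mono (n + N))‖ ≤
          ∑ n ∈ Finset.range M, ‖z‖ ^ n * ‖Q (mono (n + N))‖ := by
        refine norm_sum_le_of_le _ fun n _ => ?_
        rw [norm_smul, norm_pow, RCLike.norm_conj]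
        gcongr ?_ * _
        exact pow_le_pow_of_le_one (norm_nonneg _) hz1.le (Nat.le_add_right _ _)
      have h2 : ∑ n ∈ Finset.range M, (‖z‖ ^ n) ^ 2 ≤ (1 - ‖z‖ ^ 2)⁻¹ := by
        have := hasSum_geometric_sq hz
        simp only [norm_pow, RCLike.norm_conj] at this
        exact sum_le_hasSum _ (fun _ _ => by positivity) this
      calc _ ≤ (∑ n ∈ Finset.range M, ‖z‖ ^ n * ‖Q (mono (n + N))‖) ^ 2 := by gcongr
        _ ≤ (∑ n ∈ Finset.range M, (‖z‖ ^ n) ^ 2) *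
            ∑ n ∈ Finset.range M, ‖Q (mono (n + N))‖ ^ 2 :=
          Finset.sum_mul_sq_le_sq_mul_sq _ _ _
        _ ≤ _ := by
          gcongr
          exact hδ M
    have hsplit : ∑ n ∈ Finset.range (M + N), conj z ^ n • Q (mono n) =
        ∑ n ∈ Finset.range N, conj z ^ n • Q (mono n) +
          ∑ n ∈ Finset.range M, conj z ^ (n + N) • Q (mono (n + N)) := by
      rw [add_comm M N, Finset.sum_range_add]
      simp only [add_comm N]
    rw [hsplit]
    have h3 := norm_add_le (∑ n ∈ Finset.range N, conj z ^ n • Q (mono n))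
      (∑ n ∈ Finset.range M, conj z ^ (n + N) • Q (mono (n + N)))
    set α := ‖∑ n ∈ Finset.range N, conj z ^ n • Q (mono n)‖
    set β := ‖∑ n ∈ Finset.range M, conj z ^ (n + N) • Q (mono (n + N))‖
    have h4 : α ^ 2 ≤ (N : ℝ) ^ 2 := by gcongr
    calc _ ≤ (α + β) ^ 2 := by gcongr
      _ ≤ 2 * α ^ 2 + 2 * β ^ 2 := by nlinarith [sq_nonneg (α - β)]
      _ ≤ _ := by linarith
  have hlim := le_of_tendsto' ((hk.norm).pow 2) hfin
  calc _ ≤ (1 - ‖z‖ ^ 2) * (2 * N ^ 2 + 2 * ((1 - ‖z‖ ^ 2)⁻¹ * δ)) := by gcongr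
    _ = _ := by field_simp

/-- An inner function in the Dirichlet space has modulus tending to one at the circle. With `V` the
multiplication by `φ` and `Q = 1 - V V†`, the vectors `Q (mono n)` are square-summable because `φ`
has finite Dirichlet integral, and `‖Q k‖² = (1 - |φ z|²) ‖k‖²` for the reproducing kernel `k`
at `z`. -/
lemma IsInner.unimodularAtBoundary {φ : ℂ → ℂ} (hφ : IsInner φ) (hm : Set.MapsTo φ disc disc)
    (hD : φ ∈ dirichlet) : UnimodularAtBoundary φ := by
  obtain ⟨p, hp⟩ := exists_hardy_of_mem_dirichlet hD
  obtain ⟨E, hE⟩ := (hardy_mem_dirichlet_iff p).1 (dirichlet_congr hp hD)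
  obtain ⟨V, hV, hVmono, hVev⟩ := hφ.exists_isometry hp
  set Q : Hardy →L[ℂ] Hardy := 1 - V * adjoint V with hQ
  have hQx : ∀ x, Q x = x - V (adjoint V x) := fun x => rfl
  have hQn : ∀ x, ‖Q x‖ ^ 2 = ‖x‖ ^ 2 - ‖adjoint V x‖ ^ 2 := fun x => by
    rw [hQx, norm_sq_eq_adjoint hV x]; ring
  have hmono1 : ∀ n, ‖mono n‖ = 1 := fun n => by simp [mono, lp.norm_single]
  have hpn : ‖p‖ = 1 := by
    rw [← hmono1 0, ← hV (mono 0), hVmono]; simp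
  -- the norms of the columns of `Q`
  have hcol : ∀ n, ‖Q (mono n)‖ ^ 2 = ‖(B ^ (n + 1)) p‖ ^ 2 := fun n => by
    have h1 : ∀ j, adjoint V (mono n) j = conj ((S ^ j) p n) := fun j => by
      rw [← inner_mono, ContinuousLinearMap.adjoint_inner_right, hVmono, ← inner_conj_symm,
        inner_mono]
    have h2 : HasSum (fun j => ‖adjoint V (mono n) j‖ ^ 2)
        (∑ j ∈ Finset.range (n + 1), ‖p (n - j)‖ ^ 2) := by
      have h3 : ∀ j, ‖adjoint V (mono n) j‖ ^ 2 = if j ∈ Finset.range (n + 1) then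
          ‖p (n - j)‖ ^ 2 else 0 := fun j => by
        rw [h1, RCLike.norm_conj, S_pow_apply]
        simp only [Finset.mem_range, Nat.lt_succ_iff]
        split_ifs <;> simp
      simp_rw [h3]
      rw [← Finset.sum_congr rfl fun j hj => if_pos hj]
      exact hasSum_sum_of_ne_finset_zero fun j hj => if_neg hj
    have h4 : ∑ j ∈ Finset.range (n + 1), ‖p (n - j)‖ ^ 2 =
        ∑ j ∈ Finset.range (n + 1), ‖p j‖ ^ 2 := by
      simpa using Finset.sum_range_reflect (fun j => ‖p j‖ ^ 2) (n + 1)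
    have h5 := p.hasSum_sq.summable.sum_add_tsum_nat_add (n + 1)
    rw [(norm_B_pow_sq (n + 1) p).tsum_eq, p.hasSum_sq.tsum_eq] at h5
    rw [hpn] at h5
    rw [hQn, (Hardy.hasSum_sq _).unique h2, h4, hmono1, ← h5, add_sub_cancel_left]
  have hcol1 : ∀ n, ‖Q (mono n)‖ ≤ 1 := fun n => by
    have := hQn (mono n)
    rw [hmono1] at this
    nlinarith [sq_nonneg ‖adjoint V (mono n)‖, norm_nonneg (Q (mono n))]
  have hsum : Summable fun n => ‖Q (mono n)‖ ^ 2 := by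
    simp_rw [hcol]
    exact summable_of_sum_range_le (fun _ => by positivity) hE
  -- the defect of `φ` in terms of the reproducing kernel
  have hker : ∀ z ∈ disc, 1 - ‖φ z‖ ^ 2 = (1 - ‖z‖ ^ 2) * ‖Q (kern z)‖ ^ 2 := fun z hz => by
    have h1 : adjoint V (kern z) = conj (φ z) • kern z := by
      refine ext_inner_right ℂ fun x => ?_
      rw [ContinuousLinearMap.adjoint_inner_left, ← ev_eq_inner, hVev z hz, inner_smul_left,
        Complex.conj_conj, ev_eq_inner]
    have h2 : 1 - ‖z‖ ^ 2 ≠ 0 := by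
      have := mem_disc.1 hz
      nlinarith [norm_nonneg z]
    rw [hQn, h1, norm_smul, RCLike.norm_conj, mul_pow, norm_kern_sq hz]
    field_simp
  have hlim : Tendsto (fun z => 1 - ‖φ z‖ ^ 2) boundary (𝓝 0) := by
    refine tendsto_order.2 ⟨fun b hb => ?_, fun b hb => ?_⟩
    · filter_upwards [eventually_boundary_mem_disc] with z hz
      have := mem_disc.1 (hm hz)
      nlinarith [norm_nonneg (φ z)]
    · obtain ⟨N, hN⟩ := ((tendsto_sum_nat_add fun n => ‖Q (mono n)‖ ^ 2).eventually_lt_const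
        (show (0 : ℝ) < b / 4 by linarith)).exists
      have hδ : ∀ M, ∑ n ∈ Finset.range M, ‖Q (mono (n + N))‖ ^ 2 ≤ b / 4 := fun M =>
        (((summable_nat_add_iff N).2 hsum).sum_le_tsum _ fun _ _ => by positivity).trans hN.le
      have h2 : Tendsto (fun z : ℂ => 2 * (N : ℝ) ^ 2 * (1 - ‖z‖ ^ 2)) boundary (𝓝 0) := by
        simpa using ((tendsto_norm_boundary.pow 2).const_sub 1).const_mul (2 * (N : ℝ) ^ 2)
      filter_upwards [eventually_boundary_mem_disc,
        h2.eventually_lt_const (show (0 : ℝ) < b / 4 by linarith)] with z hz h3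
      have := mul_norm_apply_kern_sq_le hcol1 hδ hz
      rw [← hker z hz] at this
      linarith
  have h3 := (hlim.const_sub 1).sqrt
  simpa [UnimodularAtBoundary, Real.sqrt_sq] using h3

end DirichletSpace

theorem theorem2p2 (φ : ℂ → ℂ) (hφ : DirichletSpace.IsInner φ)
    (hself : Set.MapsTo φ DirichletSpace.disc DirichletSpace.disc) :
    DirichletSpace.multiplierSpace φ = DirichletSpace.multipliers ↔
      DirichletSpace.IsFiniteBlaschkeProduct φ := by
  refine ⟨fun h => ?_, fun h =>
    DirichletSpace.multiplierSpace_eq_multipliers h hφ.differentiableOn hself⟩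
  have h1 : (fun _ => (1 : ℂ)) ∈ DirichletSpace.multiplierSpace φ := by
    rw [h]
    exact DirichletSpace.analytic_mem_multipliers analyticOnNhd_const
  obtain ⟨-, C, hC⟩ := h1
  have hD : φ ∈ DirichletSpace.dirichlet := by
    have h2 := (hC _ DirichletSpace.id_mem_dirichlet).1
    unfold DirichletSpace.weightedComp at h2
    simpa using h2
  exact (hφ.unimodularAtBoundary hself hD).isFiniteBlaschkeProduct hφ.differentiableOn
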